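/- Let $\mathrm{Lie}[a,b]$ be the free Lie algebra over $\mathbb{Q}$ on two generators, and let $\mathrm{Der}^0$ be the Lie algebra of derivations $D$ of $\mathrm{Lie}[a,b]$ such that $D([a,b])=0$ and neither $D(a)$ nor $D(b)$ has a linear term in $a$, with bracket $[D_1,D_2]=D_1D_2-D_2D_1$. Put $C_i=\mathrm{ad}(a)^{i-1}(b)$ for $i\ge 1$, so that $\mathrm{Lie}[a,b]=\mathbb{Q}a\oplus\mathrm{Lie}[C_1,C_2,\dots]$, the second summand being free on the $C_i$. For $F\in \mathrm{Lie}[C_1,C_2,\dots]$, expanded as a noncommutative polynomial in the $C_i$, let $\mathrm{ma}(F)$ be the family $(\mathrm{ma}(F)_r)_{r\ge 0}$ obtained from the linear map $C_{i_1}\cdots C_{i_r}\mapsto (-1)^{i_1+\cdots+i_r-r}u_1^{i_1-1}\cdots u_r^{i_r-1}$, the degree $r$ part in the $C_i$ giving $\mathrm{ma}(F)_r\in\mathbb{Q}[u_1,\dots,u_r]$. A mould is a family $A=(A_r)_{r\ge 0}$ with $A_r\in\mathbb{Q}(u_1,\dots,u_r)$; write $A(u_1,\dots,u_r)$ for $A_r$.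 Let $\mathrm{ARI}$ be the $\mathbb{Q}$-vector space of moulds with $A_0=0$. For $A,B\in\mathrm{ARI}$ set $$\mathrm{ari}(A,B)=\mathrm{arit}(B)\cdot A-\mathrm{arit}(A)\cdot B+\mathrm{lu}(A,B),\qquad \mathrm{lu}(A,B)=\mathrm{mu}(A,B)-\mathrm{mu}(B,A),$$ $$\mathrm{mu}(A,B)(u_1,\dots,u_r)=\sum_{i=0}^rA(u_1,\dots,u_i)B(u_{i+1},\dots,u_r),$$ $$(\mathrm{arit}(B)\cdot A)(u_1,\dots,u_r)=\sum_{0\le k<\ell<r}A(u_1,\dots,u_k,u_{k+1}+\cdots+u_{\ell+1},u_{\ell+2},\dots,u_r)\,B(u_{k+1},\dots,u_\ell)$$ $$\qquad-\sum_{1\le k<\ell\le r}A(u_1,\dots,u_{k-1},u_k+\cdots+u_\ell,u_{\ell+1},\dots,u_r)\,B(u_{k+1},\dots,u_\ell).$$ Define $\Psi:\mathrm{Der}^0\to\mathrm{ARI}$ by $\Psi(D)_0=0$ and $$\Psi(D)(u_1,\dots,u_r)=\frac{\mathrm{ma}(D(a))(u_1,\dots,u_r)}{u_1\cdots u_r(u_1+\cdots+u_r)}\qquad(r\ge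 1).$$ Theorem. The map $\Psi$ is an injective Lie algebra morphism, that is, it is $\mathbb{Q}$-linear, injective, and for all $D_1,D_2\in\mathrm{Der}^0$ $$\Psi([D_1,D_2])=\mathrm{ari}\bigl(\Psi(D_1),\Psi(D_2)\bigr).$$ -/

import Mathlib

namespace EllipticMould

noncomputable section

/- Associative algebras carry the commutator bracket. -/
attribute [local instance 100] LieRing.ofAssociativeRing

/-! ### The free Lie algebra on `a`, `b` and its derivations -/

/-- The free Lie algebra `Lie[a,b]` over `ℚ`. -/
abbrev LieAB : Type := FreeLieAlgebra ℚ (Fin 2)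

/-- The generator `a`. -/
def genA : LieAB := FreeLieAlgebra.of ℚ 0

/-- The generator `b`. -/
def genB : LieAB := FreeLieAlgebra.of ℚ 1

/-- The coefficient of `a` in the linear part of an element of `Lie[a,b]`: the Lie morphism to the
abelian Lie algebra `ℚ` with `a ↦ 1`, `b ↦ 0`; it vanishes on all brackets. -/
def coeffA : LieAB →ₗ⁅ℚ⁆ ℚ := FreeLieAlgebra.lift ℚ ![1, 0]

theorem coeffA_genA : coeffA genA = 1 := by
  simp [coeffA, genA]

theorem coeffA_genB : coeffA genB = 0 := by
  simp [coeffA, genB]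

theorem coeffA_lie (x y : LieAB) : coeffA ⁅x, y⁆ = 0 := by
  rw [LieHom.map_lie, Ring.lie_def, mul_comm, sub_self]

/-- A derivation whose values on `a` and `b` have no linear term in `a` has no value with a linear
term in `a`. -/
theorem coeffA_derivation (D : LieDerivation ℚ LieAB LieAB) (ha : coeffA (D genA) = 0)
    (hb : coeffA (D genB) = 0) (x : LieAB) : coeffA (D x) = 0 := by
  let φ : LieAB →ₗ⁅ℚ⁆ ℚ :=
    { (coeffA : LieAB →ₗ[ℚ] ℚ) ∘ₗ (D : LieAB →ₗ[ℚ] LieAB) with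
      map_lie' := by
        intro x y
        change coeffA (D ⁅x, y⁆) = ⁅coeffA (D x), coeffA (D y)⁆
        rw [LieDerivation.apply_lie_eq_sub, map_sub, coeffA_lie, coeffA_lie, Ring.lie_def,
          mul_comm, sub_self, sub_self] }
  have h : φ = 0 := by
    apply FreeLieAlgebra.hom_ext
    intro i
    fin_cases i
    · exact ha
    · exact hb
  exact congrArg (fun f : LieAB →ₗ⁅ℚ⁆ ℚ => f x) h

/-- `Der⁰ Lie[a,b]`: the derivations of `Lie[a,b]` that kill `[a,b]` and whose values on `a` and
`b` have no linear term in `a`, as a Lie subalgebra of `Der Lie[a,b]` with the commutator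
bracket. -/
def Der0 : LieSubalgebra ℚ (LieDerivation ℚ LieAB LieAB) where
  carrier := {D | D ⁅genA, genB⁆ = 0 ∧ coeffA (D genA) = 0 ∧ coeffA (D genB) = 0}
  zero_mem' := by simp
  add_mem' := by
    rintro D E ⟨h1, h2, h3⟩ ⟨h4, h5, h6⟩
    simp only [Set.mem_ofPred_eq, LieDerivation.add_apply, map_add] at *
    simp [h1, h2, h3, h4, h5, h6]
  smul_mem' := by
    rintro c D ⟨h1, h2, h3⟩
    simp only [Set.mem_ofPred_eq, LieDerivation.smul_apply, map_smul] at *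
    simp [h1, h2, h3]
  lie_mem' := by
    rintro D E ⟨h1, h2, h3⟩ ⟨h4, h5, h6⟩
    simp only [Set.mem_ofPred_eq, LieDerivation.lie_apply, map_sub, h1, h4, map_zero, sub_self,
      coeffA_derivation D h2 h3, coeffA_derivation E h5 h6, and_self]

/-! ### Lazard elimination: `Lie[a,b] = ℚa ⊕ Lie[C₁, C₂, …]` with `Cᵢ = ad(a)^(i-1)(b)`

The index is shifted: the letter `n : ℕ` stands for `C_{n+1} = ad(a)^n (b)`. -/

/-- The noncommutative polynomial ring `ℚ⟨C₁, C₂, …⟩`. -/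
abbrev PolyC : Type := FreeAlgebra ℚ ℕ

/-- The Lie morphism `Lie[C₁, C₂, …] → Lie[a,b]` with `C_{n+1} ↦ ad(a)^n (b)`. -/
def expandC : FreeLieAlgebra ℚ ℕ →ₗ⁅ℚ⁆ LieAB :=
  FreeLieAlgebra.lift ℚ fun n => ((LieAlgebra.ad ℚ LieAB genA) ^ n) genB

/-- The canonical map `Lie[C₁, C₂, …] → ℚ⟨C₁, C₂, …⟩`, expanding brackets as commutators. -/
def assocC : FreeLieAlgebra ℚ ℕ →ₗ⁅ℚ⁆ PolyC :=
  FreeLieAlgebra.lift ℚ (FreeAlgebra.ι ℚ)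

/-- Auxiliary algebra morphism `P ↦ P + ε ∂P` for the derivation `∂` below. -/
def shiftHom : PolyC →ₐ[ℚ] TrivSqZeroExt PolyC PolyC :=
  FreeAlgebra.lift ℚ fun n =>
    TrivSqZeroExt.inl (FreeAlgebra.ι ℚ n) + TrivSqZeroExt.inr (FreeAlgebra.ι ℚ (n + 1))

/-- The derivation `∂` of `ℚ⟨C₁, C₂, …⟩` with `∂ Cᵢ = Cᵢ₊₁`, that is, the action of `ad(a)`. -/
def shiftC : PolyC →ₗ[ℚ] PolyC where
  toFun P := (shiftHom P).snd
  map_add' P Q := by rw [map_add, TrivSqZeroExt.snd_add]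
  map_smul' c P := by rw [map_smul, TrivSqZeroExt.snd_smul, RingHom.id_apply]

/-- The representation of `Lie[a,b]` on `ℚ⟨C₁, C₂, …⟩` in which `a` acts as `∂` and `b` as left
multiplication by `C₁`. -/
def actC : LieAB →ₗ⁅ℚ⁆ Module.End ℚ PolyC :=
  FreeLieAlgebra.lift ℚ ![shiftC, LinearMap.mulLeft ℚ (FreeAlgebra.ι ℚ 0)]

/-- The expression of an element of `Lie[a,b]` as a polynomial in the `Cᵢ`, its component in `ℚa`
being dropped. It is characterized by `toPolyC_eq` and `exists_eq_expandC`. -/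
def toPolyC : LieAB →ₗ[ℚ] PolyC where
  toFun F := actC F 1
  map_add' F G := by rw [map_add, LinearMap.add_apply]
  map_smul' c F := by rw [map_smul, LinearMap.smul_apply, RingHom.id_apply]

theorem shiftHom_fst (P : PolyC) : (shiftHom P).fst = P := by
  have h : (TrivSqZeroExt.fstHom ℚ PolyC PolyC).comp shiftHom = AlgHom.id ℚ PolyC := by
    ext n
    simp [shiftHom]
  exact congrArg (fun f : PolyC →ₐ[ℚ] PolyC => f P) h

theorem shiftC_ι (n : ℕ) : shiftC (FreeAlgebra.ι ℚ n) = FreeAlgebra.ι ℚ (n + 1) := by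
  change (shiftHom (FreeAlgebra.ι ℚ n)).snd = _
  simp [shiftHom]

theorem shiftC_one : shiftC 1 = 0 := by
  change (shiftHom 1).snd = _
  simp

theorem shiftC_mul (P Q : PolyC) : shiftC (P * Q) = shiftC P * Q + P * shiftC Q := by
  change (shiftHom (P * Q)).snd = (shiftHom P).snd * Q + P * (shiftHom Q).snd
  rw [map_mul, TrivSqZeroExt.snd_mul, shiftHom_fst, shiftHom_fst, add_comm]
  rfl

theorem actC_genA : actC genA = shiftC := by simp [actC, genA]

theorem actC_genB : actC genB = LinearMap.mulLeft ℚ (FreeAlgebra.ι ℚ 0) := by simp [actC, genB]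

theorem actC_ad (n : ℕ) : actC (((LieAlgebra.ad ℚ LieAB genA) ^ n) genB) =
    LinearMap.mulLeft ℚ (FreeAlgebra.ι ℚ n) := by
  induction n with
  | zero => simpa using actC_genB
  | succ n ih =>
    rw [pow_succ', Module.End.mul_apply, LieAlgebra.ad_apply, LieHom.map_lie, ih, actC_genA,
      Ring.lie_def]
    ext P
    simp [shiftC_mul, shiftC_ι]

theorem actC_expandC (P : FreeLieAlgebra ℚ ℕ) :
    actC (expandC P) = LinearMap.mulLeft ℚ (assocC P) := by
  let ψ : FreeLieAlgebra ℚ ℕ →ₗ⁅ℚ⁆ Module.End ℚ PolyC :=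
    { toFun := fun P => LinearMap.mulLeft ℚ (assocC P)
      map_add' := by intro x y; ext z; simp [add_mul]
      map_smul' := by intro c x; ext z; simp
      map_lie' := by
        intro x y
        ext z
        simp [Ring.lie_def, sub_mul, mul_assoc] }
  have h : actC.comp expandC = ψ := by
    apply FreeLieAlgebra.hom_ext
    intro n
    change actC (expandC (FreeLieAlgebra.of ℚ n)) =
      LinearMap.mulLeft ℚ (assocC (FreeLieAlgebra.of ℚ n))
    rw [expandC, assocC, FreeLieAlgebra.lift_of_apply, FreeLieAlgebra.lift_of_apply, actC_ad]
  exact congrArg (fun f : FreeLieAlgebra ℚ ℕ →ₗ⁅ℚ⁆ Module.End ℚ PolyC => f P) h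

/-- On `ℚa ⊕ Lie[C₁, C₂, …]`, `toPolyC` is the expansion of the second component. -/
theorem toPolyC_eq (c : ℚ) (P : FreeLieAlgebra ℚ ℕ) :
    toPolyC (c • genA + expandC P) = assocC P := by
  change actC (c • genA + expandC P) 1 = _
  rw [map_add, map_smul, actC_genA, actC_expandC]
  simp [shiftC_one]

/-- A Lie subalgebra containing the images of the generators contains the image of a free Lie
algebra. -/
theorem mem_of_generators {X M : Type} [LieRing M] [LieAlgebra ℚ M]
    (f : FreeLieAlgebra ℚ X →ₗ⁅ℚ⁆ M) (S : LieSubalgebra ℚ M)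
    (h : ∀ x, f (FreeLieAlgebra.of ℚ x) ∈ S) (P : FreeLieAlgebra ℚ X) : f P ∈ S := by
  let g : FreeLieAlgebra ℚ X →ₗ⁅ℚ⁆ S :=
    FreeLieAlgebra.lift ℚ fun x => ⟨f (FreeLieAlgebra.of ℚ x), h x⟩
  have hg : S.incl.comp g = f := by
    apply FreeLieAlgebra.hom_ext
    intro x
    simp [g]
  rw [← hg]
  exact (g P).2

theorem expandC_of (n : ℕ) :
    expandC (FreeLieAlgebra.of ℚ n) = ((LieAlgebra.ad ℚ LieAB genA) ^ n) genB := by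
  rw [expandC, FreeLieAlgebra.lift_of_apply]

theorem coeffA_expandC (P : FreeLieAlgebra ℚ ℕ) : coeffA (expandC P) = 0 := by
  have h : coeffA.comp expandC = 0 := by
    apply FreeLieAlgebra.hom_ext
    intro n
    change coeffA (expandC (FreeLieAlgebra.of ℚ n)) = 0
    rw [expandC_of]
    cases n with
    | zero => exact coeffA_genB
    | succ n => rw [pow_succ', Module.End.mul_apply, LieAlgebra.ad_apply, coeffA_lie]
  exact congrArg (fun f : FreeLieAlgebra ℚ ℕ →ₗ⁅ℚ⁆ ℚ => f P) h

theorem lie_genA_expandC (P : FreeLieAlgebra ℚ ℕ) : ⁅genA, expandC P⁆ ∈ expandC.range := by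
  let S : LieSubalgebra ℚ LieAB :=
    { carrier := {x | x ∈ expandC.range ∧ ⁅genA, x⁆ ∈ expandC.range}
      zero_mem' := by
        refine ⟨zero_mem _, ?_⟩
        rw [lie_zero]
        exact zero_mem _
      add_mem' := by
        rintro x y ⟨h1, h2⟩ ⟨h3, h4⟩
        refine ⟨add_mem h1 h3, ?_⟩
        rw [lie_add]
        exact add_mem h2 h4
      smul_mem' := by
        rintro c x ⟨h1, h2⟩
        refine ⟨expandC.range.smul_mem c h1, ?_⟩
        rw [lie_smul]
        exact expandC.range.smul_mem c h2
      lie_mem' := by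
        rintro x y ⟨h1, h2⟩ ⟨h3, h4⟩
        refine ⟨expandC.range.lie_mem h1 h3, ?_⟩
        rw [leibniz_lie]
        exact add_mem (expandC.range.lie_mem h2 h3) (expandC.range.lie_mem h1 h4) }
  refine (mem_of_generators expandC S (fun n => ⟨⟨_, rfl⟩, ?_⟩) P).2
  refine ⟨FreeLieAlgebra.of ℚ (n + 1), ?_⟩
  rw [LieHom.coe_toLinearMap, expandC_of, expandC_of, pow_succ', Module.End.mul_apply,
    LieAlgebra.ad_apply]

/-- Every `F` in `Lie[a,b]` is the sum of its linear term in `a` and of a Lie polynomial in the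
`Cᵢ`. -/
theorem exists_eq_expandC (F : LieAB) :
    ∃ P : FreeLieAlgebra ℚ ℕ, F = coeffA F • genA + expandC P := by
  let S : LieSubalgebra ℚ LieAB :=
    { carrier := {x | ∃ c : ℚ, ∃ y ∈ expandC.range, x = c • genA + y}
      zero_mem' := ⟨0, 0, zero_mem _, by simp⟩
      add_mem' := by
        rintro _ _ ⟨c, x, hx, rfl⟩ ⟨d, y, hy, rfl⟩
        exact ⟨c + d, x + y, add_mem hx hy, by rw [add_smul]; abel⟩
      smul_mem' := by
        rintro t _ ⟨c, x, hx, rfl⟩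
        exact ⟨t * c, t • x, expandC.range.smul_mem t hx, by rw [smul_add, smul_smul]⟩
      lie_mem' := by
        rintro _ _ ⟨c, _, ⟨x, rfl⟩, rfl⟩ ⟨d, _, ⟨y, rfl⟩, rfl⟩
        refine ⟨0, c • ⁅genA, expandC y⁆ - d • ⁅genA, expandC x⁆ + ⁅expandC x, expandC y⁆,
          add_mem (sub_mem (expandC.range.smul_mem c (lie_genA_expandC y))
            (expandC.range.smul_mem d (lie_genA_expandC x)))
            (expandC.range.lie_mem ⟨x, rfl⟩ ⟨y, rfl⟩), ?_⟩
        simp only [LieHom.coe_toLinearMap, add_lie, lie_add, smul_lie, lie_smul, lie_self,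
          smul_zero, zero_smul, zero_add]
        rw [← lie_skew (expandC x) genA, smul_neg]
        abel }
  have h : F ∈ S := by
    refine mem_of_generators (LieHom.id : LieAB →ₗ⁅ℚ⁆ LieAB) S (fun i => ?_) F
    fin_cases i
    · exact ⟨1, 0, zero_mem _, by simp [genA]⟩
    · exact ⟨0, genB, ⟨FreeLieAlgebra.of ℚ 0, expandC_of 0⟩,
        by simp [genB]⟩
  obtain ⟨c, _, ⟨P, rfl⟩, h⟩ := h
  refine ⟨P, ?_⟩
  have hc : coeffA F = c := by
    rw [h, LieHom.coe_toLinearMap, map_add, map_smul, coeffA_genA, coeffA_expandC]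
    simp
  rw [hc]
  exact h

/-! ### Moulds -/

/-- Rational functions over `ℚ` in the commutative variables `u₁, …, u_r`. -/
def RatFun (r : ℕ) : Type := FractionRing (MvPolynomial (Fin r) ℚ)

instance (r : ℕ) : Field (RatFun r) :=
  inferInstanceAs (Field (FractionRing (MvPolynomial (Fin r) ℚ)))

instance (r : ℕ) : Algebra (MvPolynomial (Fin r) ℚ) (RatFun r) :=
  inferInstanceAs (Algebra (MvPolynomial (Fin r) ℚ) (FractionRing (MvPolynomial (Fin r) ℚ)))

instance (r : ℕ) : IsFractionRing (MvPolynomial (Fin r) ℚ) (RatFun r) :=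
  inferInstanceAs (IsFractionRing (MvPolynomial (Fin r) ℚ)
    (FractionRing (MvPolynomial (Fin r) ℚ)))

instance (r : ℕ) : CharZero (RatFun r) :=
  charZero_of_injective_algebraMap
    (IsFractionRing.injective (MvPolynomial (Fin r) ℚ) (RatFun r))

instance (r : ℕ) : IsScalarTower ℚ (MvPolynomial (Fin r) ℚ) (RatFun r) :=
  IsScalarTower.of_algebraMap_eq' (Subsingleton.elim _ _)

/-- A (rational) mould: a collection `(A_r)_{r ≥ 0}` with `A_r` a rational function of
`u₁, …, u_r`. -/
abbrev Mould : Type := ∀ r : ℕ, RatFun r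

/-- The space `ARI` of moulds with `A(∅) = 0`. -/
def ARI : Submodule ℚ Mould where
  carrier := {A | A 0 = 0}
  zero_mem' := rfl
  add_mem' := by
    intro A B hA hB
    simp only [Set.mem_ofPred_eq, Pi.add_apply] at *
    rw [hA, hB, add_zero]
  smul_mem' := by
    intro c A hA
    simp only [Set.mem_ofPred_eq, Pi.smul_apply] at *
    rw [hA]
    exact smul_zero (A := RatFun 0) c

/-- The value of a rational function at a point with coordinates in a field extension of `ℚ`,
computed from its reduced fraction. -/
def ratEval {L : Type} [Field L] [Algebra ℚ L] {m : ℕ} (f : RatFun m) (w : Fin m → L) : L :=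
  MvPolynomial.aeval w (IsFractionRing.num (MvPolynomial (Fin m) ℚ) f) /
    MvPolynomial.aeval w (IsFractionRing.den (MvPolynomial (Fin m) ℚ) f : MvPolynomial (Fin m) ℚ)

/-- The value of a rational function can be computed from any fraction whose denominator does not
vanish at the point. -/
theorem ratEval_eq {L : Type} [Field L] [Algebra ℚ L] {m : ℕ} (f : RatFun m) (w : Fin m → L)
    (p q : MvPolynomial (Fin m) ℚ) (hq : MvPolynomial.aeval w q ≠ 0)
    (h : f * algebraMap _ (RatFun m) q = algebraMap _ (RatFun m) p) :
    ratEval f w = MvPolynomial.aeval w p / MvPolynomial.aeval w q := by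
  set n := IsFractionRing.num (MvPolynomial (Fin m) ℚ) f with hn
  set d := (IsFractionRing.den (MvPolynomial (Fin m) ℚ) f : MvPolynomial (Fin m) ℚ) with hd
  have hd0 : algebraMap (MvPolynomial (Fin m) ℚ) (RatFun m) d ≠ 0 :=
    IsFractionRing.to_map_ne_zero_of_mem_nonZeroDivisors
      (IsFractionRing.den (MvPolynomial (Fin m) ℚ) f).2
  have hf : f * algebraMap _ (RatFun m) d = algebraMap _ (RatFun m) n := by
    have := IsFractionRing.mk'_num_den' (MvPolynomial (Fin m) ℚ) f
    rw [← hn, ← hd] at this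
    rw [← this, div_mul_cancel₀ _ hd0]
  have key : n * q = p * d := by
    apply IsFractionRing.injective (MvPolynomial (Fin m) ℚ) (RatFun m)
    rw [map_mul, map_mul, ← h, ← hf]
    ring
  have hdvd : d ∣ q := by
    have hrel := IsFractionRing.num_den_reduced (MvPolynomial (Fin m) ℚ) f
    exact (IsRelPrime.dvd_of_dvd_mul_left hrel.symm ⟨p, by rw [key, mul_comm]⟩)
  have hdw : MvPolynomial.aeval w d ≠ 0 := by
    obtain ⟨e, rfl⟩ := hdvd
    rw [map_mul] at hq
    exact left_ne_zero_of_mul hq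
  change MvPolynomial.aeval w n / MvPolynomial.aeval w d = _
  rw [div_eq_div_iff hdw hq, ← map_mul, ← map_mul, key]

/-- The value `A(w)` of a mould at a tuple `w = (w₁, …, w_m)`. -/
def evalAt {L : Type} [Field L] [Algebra ℚ L] (A : Mould) (w : List L) : L :=
  ratEval (A w.length) w.get

/-- The tuple of variables `(u₁, …, u_r)`. -/
def vars (r : ℕ) : List (RatFun r) :=
  List.ofFn fun i : Fin r => algebraMap (MvPolynomial (Fin r) ℚ) (RatFun r) (MvPolynomial.X i)

/-- `a⌈c`: for `w = abc` with `c` nonempty, the sum of the entries of `b` is added to the first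
entry of `c`, and `b` is removed. -/
def flexLeft {L : Type} [Field L] (a b c : List L) : List L :=
  a ++ (b.sum + c.headD 0) :: c.tail

/-- `a⌉c`: for `w = abc` with `a` nonempty, the sum of the entries of `b` is added to the last
entry of `a`, and `b` is removed. -/
def flexRight {L : Type} [Field L] (a b c : List L) : List L :=
  a.dropLast ++ (a.getLastD 0 + b.sum) :: c

/-- The operator `arit(B)` applied to `A`; here `(u₁, …, u_r)` is broken into
`a = (u₁, …, u_k)`, `b = (u_{k+1}, …, u_ℓ)`, `c = (u_{ℓ+1}, …, u_r)`, with `0 ≤ k < ℓ < r` in the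
first sum and `1 ≤ k < ℓ ≤ r` in the second. -/
def arit (B A : Mould) : Mould := fun r =>
  (∑ l ∈ Finset.range r, ∑ k ∈ Finset.range l,
    evalAt A (flexLeft ((vars r).take k) (((vars r).take l).drop k) ((vars r).drop l)) *
      evalAt B (((vars r).take l).drop k)) -
  ∑ l ∈ Finset.Icc 1 r, ∑ k ∈ Finset.Ico 1 l,
    evalAt A (flexRight ((vars r).take k) (((vars r).take l).drop k) ((vars r).drop l)) *
      evalAt B (((vars r).take l).drop k)

/-- The product `mu(A,B)(u₁, …, u_r) = ∑_{i=0}^r A(u₁, …, u_i) B(u_{i+1}, …, u_r)`. -/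
def mu (A B : Mould) : Mould := fun r =>
  ∑ i ∈ Finset.range (r + 1), evalAt A ((vars r).take i) * evalAt B ((vars r).drop i)

/-- The bracket `lu(A,B) = mu(A,B) - mu(B,A)`. -/
def lu (A B : Mould) : Mould := mu A B - mu B A

/-- The ari-bracket `ari(A,B) = arit(B)·A - arit(A)·B + lu(A,B)` on `ARI`. -/
def ari (A B : ARI) : ARI :=
  ⟨arit B.1 A.1 - arit A.1 B.1 + lu A.1 B.1, by
    change (arit B.1 A.1 - arit A.1 B.1 + lu A.1 B.1) 0 = 0
    simp [arit, lu, mu, vars, mul_comm]⟩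

/-! ### From Lie polynomials to moulds -/

/-- The linear map `ma` on `ℚ⟨C₁, C₂, …⟩`: the monomial
`C_{n₁+1} ⋯ C_{n_r+1}` is sent to `(-1)^(n₁+⋯+n_r) u₁^{n₁} ⋯ u_r^{n_r}` in depth `r` and to `0` in
the other depths. -/
def maPoly : PolyC →ₗ[ℚ] (∀ r : ℕ, MvPolynomial (Fin r) ℚ) :=
  (FreeAlgebra.basisFreeMonoid ℚ ℕ).constr ℚ fun w r =>
    if w.length = r then
      (-1) ^ w.toList.sum * ∏ i : Fin r, MvPolynomial.X i ^ w.toList.getD i 0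
    else 0

/-- `ma(F)` for a Lie polynomial `F`, written as a polynomial in the `Cᵢ`. -/
def ma : LieAB →ₗ[ℚ] (∀ r : ℕ, MvPolynomial (Fin r) ℚ) := maPoly ∘ₗ toPolyC

/-- `Δ_r = u₁ ⋯ u_r (u₁ + ⋯ + u_r)`. -/
def Delta (r : ℕ) : MvPolynomial (Fin r) ℚ :=
  (∏ i : Fin r, MvPolynomial.X i) * ∑ i : Fin r, MvPolynomial.X i

/-- The mould `ma(F)(u₁, …, u_r) / Δ_r` in depth `r ≥ 1`, with value `0` in depth `0`. -/
def Da : LieAB →ₗ[ℚ] ARI where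
  toFun F :=
    ⟨fun r => if r = 0 then 0 else
      algebraMap _ (RatFun r) (ma F r) / algebraMap _ (RatFun r) (Delta r), if_pos rfl⟩
  map_add' F G := by
    apply Subtype.ext
    funext r
    by_cases hr : r = 0
    · simp [hr]
    · simp [hr, add_div]
  map_smul' c F := by
    apply Subtype.ext
    funext r
    by_cases hr : r = 0
    · simp [hr]
    · have h : algebraMap (MvPolynomial (Fin r) ℚ) (RatFun r) (c • ma F r) =
          c • algebraMap (MvPolynomial (Fin r) ℚ) (RatFun r) (ma F r) := by
        rw [Algebra.smul_def, Algebra.smul_def, map_mul, ← IsScalarTower.algebraMap_apply]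
      simp only [map_smul, Pi.smul_apply, hr, if_false, h, smul_div_assoc]
      simp [hr]

/-- The linear map `Ψ : Der⁰ Lie[a,b] → ARI`, `Ψ(D)_r = ma(D(a)) / Δ_r`. -/
def Psi : Der0 →ₗ[ℚ] ARI where
  toFun D := Da (D.1 genA)
  map_add' D E := by
    change Da ((D.1 + E.1) genA) = _
    rw [LieDerivation.add_apply, map_add]
  map_smul' c D := by
    change Da ((c • D.1) genA) = _
    rw [LieDerivation.smul_apply, map_smul, RingHom.id_apply]

end

end EllipticMould

/-! Dividing `ma(F)` by `u₁ ⋯ u_r` gives `normMa F`; dividing once more by `u₁ + ⋯ + u_r` gives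
`deltaMa F`, so that `B_D = deltaMa (D a)` is `Ψ(D)`. On elements without linear term in `a`,
`normMa` turns brackets into `lu`, and it turns `ad(a)` into minus the multiplication `s` by the sum
of the entries (`sumMul`).

The heart is `normMa_derivation`: for `D` in `Der⁰`, `normMa (D F) = lu(B_D, normMa F) -
arit(B_D)·normMa F`. The right side is a derivation for `mu` (`aritFun_conv`, `luArit_conv`), and
its failure to commute with `s` is exactly the term coming from `[D a, F]` in `D[a, F]`
(`luArit_sumMul`). So it suffices to check `F = b`. There `s · normMa b` is the mould equal to `1`
in depth one, on which `arit(B)` coincides with `lu(B, ·)` (`aritFun_unitOne`), and the formula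
becomes `D[a,b] = 0`. Applying it to `D₁(D₂ a) - D₂(D₁ a)`, where `normMa (Dᵢ a) = s·B_{Dᵢ}`, and
cancelling `s` gives the ari-bracket (`deltaMa_lie`).

For injectivity, `ma` determines a Lie polynomial in the `Cᵢ`, because words are read off from
monomials (`maPoly_injective`) and the free Lie algebra embeds in the free associative algebra
(`assocC_injective`). So `Ψ(D) = 0` forces `D(a) = 0`; then `[a, D(b)] = 0` forces `D(b) = 0`.

Moulds are handled as functions of lists, which makes flexions plain list operations. To avoid
vanishing denominators, identities are stated only on lists with entries in an additive subsemigroup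
omitting `0`, which is stable under flexions. -/

namespace EllipticMould

attribute [local instance 100] LieRing.ofAssociativeRing

open Finset

/-! ### Sums over the deconcatenations of a list -/

section SplitSum

variable {α M : Type} [AddCommMonoid M]

/-- The sum of `φ a b` over all factorizations `w = a ++ b`. -/
def splitSum (φ : List α → List α → M) (w : List α) : M :=
  ∑ i ∈ range (w.length + 1), φ (w.take i) (w.drop i)

theorem splitSum_nil (φ : List α → List α → M) : splitSum φ [] = φ [] [] := by
  simp [splitSum]

theorem splitSum_cons (φ : List α → List α → M) (x : α) (w : List α) :
    splitSum φ (x :: w) = φ [] (x :: w) + splitSum (fun a b => φ (x :: a) b) w := by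
  rw [splitSum, List.length_cons, sum_range_succ', add_comm]
  simp [splitSum]

/-- The cut falls either before the marked letter `y` or after it. In the uses below, `y` is the
letter that has absorbed the block `b`. -/
theorem splitSum_append_cons (φ : List α → List α → M) (a : List α) (y : α) (c : List α) :
    splitSum φ (a ++ y :: c) = splitSum (fun a₁ a₂ => φ a₁ (a₂ ++ y :: c)) a +
      splitSum (fun c₁ c₂ => φ (a ++ y :: c₁) c₂) c := by
  induction a generalizing φ with
  | nil => simp [splitSum_nil, splitSum_cons]
  | cons x a ih => simp [splitSum_cons, ih, add_assoc]

theorem splitSum_concat (φ : List α → List α → M) (a : List α) (x : α) :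
    splitSum φ (a ++ [x]) = splitSum (fun a₁ a₂ => φ a₁ (a₂ ++ [x])) a + φ (a ++ [x]) [] := by
  rw [splitSum_append_cons, splitSum_nil]

theorem splitSum_add (φ ψ : List α → List α → M) (w : List α) :
    splitSum (fun a b => φ a b + ψ a b) w = splitSum φ w + splitSum ψ w :=
  sum_add_distrib

theorem splitSum_congr {φ ψ : List α → List α → M} {w : List α}
    (h : ∀ a b, a ++ b = w → φ a b = ψ a b) : splitSum φ w = splitSum ψ w :=
  sum_congr rfl fun _ _ => h _ _ (List.take_append_drop _ _)

theorem splitSum_eq_zero {φ : List α → List α → M} {w : List α}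
    (h : ∀ a b, a ++ b = w → φ a b = 0) : splitSum φ w = 0 :=
  sum_eq_zero fun _ _ => h _ _ (List.take_append_drop _ _)

/-- Coassociativity of deconcatenation. -/
theorem splitSum_assoc (φ : List α → List α → List α → M) (w : List α) :
    splitSum (fun t c => splitSum (fun a b => φ a b c) t) w =
      splitSum (fun a t => splitSum (fun b c => φ a b c) t) w := by
  induction w generalizing φ with
  | nil => simp [splitSum_nil]
  | cons x w ih => simp only [splitSum_cons, splitSum_nil, splitSum_add, ih, add_assoc]

end SplitSum

theorem mul_splitSum {α R : Type} [NonUnitalNonAssocSemiring R] (r : R)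
    (φ : List α → List α → R) (w : List α) :
    r * splitSum φ w = splitSum (fun a b => r * φ a b) w :=
  mul_sum _ _ _

theorem splitSum_mul {α R : Type} [NonUnitalNonAssocSemiring R] (r : R)
    (φ : List α → List α → R) (w : List α) :
    splitSum φ w * r = splitSum (fun a b => φ a b * r) w :=
  sum_mul _ _ _

theorem splitSum_neg {α M : Type} [AddCommGroup M] (φ : List α → List α → M) (w : List α) :
    splitSum (fun a b => -φ a b) w = -splitSum φ w :=
  sum_neg_distrib _

/-! ### Operations on functions of lists -/

section ListFun

variable {L : Type} [Field L]

/-- The concatenation product of functions of lists. -/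
def conv (f g : List L → L) : List L → L := splitSum fun a b => f a * g b

theorem conv_assoc (f g h : List L → L) : conv (conv f g) h = conv f (conv g h) := by
  funext w
  simp only [conv, splitSum_mul, mul_splitSum, mul_assoc]
  exact splitSum_assoc (fun a b c => f a * (g b * h c)) w

theorem conv_add (f g h : List L → L) : conv f (g + h) = conv f g + conv f h := by
  funext w
  simp only [conv, Pi.add_apply, mul_add, splitSum_add]

theorem add_conv (f g h : List L → L) : conv (f + g) h = conv f h + conv g h := by
  funext w
  simp only [conv, Pi.add_apply, add_mul, splitSum_add]

theorem conv_neg (f g : List L → L) : conv f (-g) = -conv f g := by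
  funext w
  simp only [conv, Pi.neg_apply, mul_neg, splitSum_neg]

theorem neg_conv (f g : List L → L) : conv (-f) g = -conv f g := by
  funext w
  simp only [conv, Pi.neg_apply, neg_mul, splitSum_neg]

theorem conv_sub (f g h : List L → L) : conv f (g - h) = conv f g - conv f h := by
  rw [sub_eq_add_neg, conv_add, conv_neg, sub_eq_add_neg]

theorem sub_conv (f g h : List L → L) : conv (f - g) h = conv f h - conv g h := by
  rw [sub_eq_add_neg, add_conv, neg_conv, sub_eq_add_neg]

/-- Multiplication by the sum of the entries. -/
def sumMul (f : List L → L) : List L → L := fun w => w.sum * f w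

theorem sumMul_conv (f g : List L → L) :
    sumMul (conv f g) = conv (sumMul f) g + conv f (sumMul g) := by
  funext w
  simp only [sumMul, conv, Pi.add_apply, mul_splitSum, ← splitSum_add]
  refine splitSum_congr fun a b h => ?_
  rw [← h, List.sum_append]
  ring

/-- `A(a⌈c)`, or `0` if `c` is empty. -/
def atLeft (A : List L → L) (a b : List L) : List L → L
  | [] => 0
  | z :: c => A (a ++ (b.sum + z) :: c)

/-- `A(a⌉c)`, or `0` if `a` is empty. -/
def atRight (A : List L → L) (a b c : List L) : L :=
  if a = [] then 0 else A (flexRight a b c)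

theorem atRight_nil (A : List L → L) (b c : List L) : atRight A [] b c = 0 := if_pos rfl

theorem atRight_concat (A : List L → L) (a : List L) (x : L) (b c : List L) :
    atRight A (a ++ [x]) b c = A (a ++ (x + b.sum) :: c) := by
  simp [atRight, flexRight, List.getLastD_eq_getLast?]

/-- The first sum in `arit B A`. -/
def aritLeft (B A : List L → L) : List L → L :=
  splitSum fun t c => splitSum (fun a b => atLeft A a b c * B b) t

/-- The second sum in `arit B A`. -/
def aritRight (B A : List L → L) : List L → L :=
  splitSum fun t c => splitSum (fun a b => atRight A a b c * B b) t

/-- A cut of the flexed word leaves the enlarged letter in one of the two factors, and that factor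
is then itself flexed. The cuts that would separate `b` from its absorbing letter contribute `0`, by
the default value of `atLeft` on an empty last argument. -/
theorem atLeft_conv (A₁ A₂ : List L → L) (a b c : List L) :
    atLeft (conv A₁ A₂) a b c = splitSum (fun c₁ c₂ => atLeft A₁ a b c₁ * A₂ c₂) c +
      splitSum (fun a₁ a₂ => A₁ a₁ * atLeft A₂ a₂ b c) a := by
  cases c with
  | nil => simp [atLeft, splitSum_eq_zero]
  | cons z c => simp [atLeft, conv, splitSum_append_cons, splitSum_cons, add_comm]

theorem atRight_conv (A₁ A₂ : List L → L) (a b c : List L) :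
    atRight (conv A₁ A₂) a b c = splitSum (fun c₁ c₂ => atRight A₁ a b c₁ * A₂ c₂) c +
      splitSum (fun a₁ a₂ => A₁ a₁ * atRight A₂ a₂ b c) a := by
  obtain rfl | ⟨a, x, rfl⟩ := a.eq_nil_or_concat
  · simp [atRight_nil, splitSum_eq_zero]
  · simp [atRight_concat, atRight_nil, conv, splitSum_append_cons, splitSum_nil, add_comm]

/-- Both halves of `arit B` are derivations for the same reason. -/
theorem derivation_of_split (B A₁ A₂ : List L → L)
    (τ : (List L → L) → List L → List L → List L → L)
    (hτ : ∀ a b c, τ (conv A₁ A₂) a b c = splitSum (fun c₁ c₂ => τ A₁ a b c₁ * A₂ c₂) c +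
      splitSum (fun a₁ a₂ => A₁ a₁ * τ A₂ a₂ b c) a) (w : List L) :
    splitSum (fun t c => splitSum (fun a b => τ (conv A₁ A₂) a b c * B b) t) w =
      splitSum (fun s d => splitSum (fun t c => splitSum (fun a b => τ A₁ a b c * B b) t) s *
        A₂ d) w +
      splitSum (fun d s => A₁ d *
        splitSum (fun t c => splitSum (fun a b => τ A₂ a b c * B b) t) s) w := by
  simp only [hτ, add_mul, splitSum_add, splitSum_mul, mul_splitSum]
  congr 1
  -- After reassociation the cuts of `t` into `a, b` and of `s` into `c, d` are independent, so the
  -- two sums commute.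
  · rw [splitSum_assoc fun t c d => splitSum (fun a b => τ A₁ a b c * B b * A₂ d) t]
    refine splitSum_congr fun t s _ => ?_
    simp only [splitSum]
    rw [sum_comm]
    exact sum_congr rfl fun _ _ => sum_congr rfl fun _ _ => by ring
  · rw [← splitSum_assoc fun d t c => splitSum (fun a b => A₁ d * (τ A₂ a b c * B b)) t]
    refine splitSum_congr fun t c _ => ?_
    rw [← splitSum_assoc fun d a b => A₁ d * (τ A₂ a b c * B b)]
    exact splitSum_congr fun _ _ _ => splitSum_congr fun _ _ _ => by ring

/-- The operator `arit B` on functions of lists. -/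
def aritFun (B A : List L → L) : List L → L := aritLeft B A - aritRight B A

theorem aritFun_conv (B A₁ A₂ : List L → L) :
    aritFun B (conv A₁ A₂) = conv (aritFun B A₁) A₂ + conv A₁ (aritFun B A₂) := by
  have hl : aritLeft B (conv A₁ A₂) = conv (aritLeft B A₁) A₂ + conv A₁ (aritLeft B A₂) :=
    funext (derivation_of_split B A₁ A₂ atLeft (atLeft_conv A₁ A₂))
  have hr : aritRight B (conv A₁ A₂) = conv (aritRight B A₁) A₂ + conv A₁ (aritRight B A₂) :=
    funext (derivation_of_split B A₁ A₂ atRight (atRight_conv A₁ A₂))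
  rw [aritFun, aritFun, aritFun, hl, hr, sub_conv, conv_sub]
  abel

/-- A flexion preserves the total sum of the entries; hence `arit` commutes with `sumMul`. -/
theorem atLeft_sumMul (A : List L → L) (a b c : List L) :
    atLeft (sumMul A) a b c = (a ++ b ++ c).sum * atLeft A a b c := by
  cases c with
  | nil => simp [atLeft]
  | cons z c => simp [atLeft, sumMul, add_assoc]

theorem atRight_sumMul (A : List L → L) (a b c : List L) :
    atRight (sumMul A) a b c = (a ++ b ++ c).sum * atRight A a b c := by
  obtain rfl | ⟨a, x, rfl⟩ := a.eq_nil_or_concat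
  · simp [atRight_nil]
  · simp [atRight_concat, sumMul, add_assoc]

theorem aritFun_sumMul (B A : List L → L) :
    aritFun B (sumMul A) = sumMul (aritFun B A) := by
  funext w
  simp only [aritFun, aritLeft, aritRight, Pi.sub_apply, sumMul, mul_sub, mul_splitSum]
  congr 1
  all_goals
    refine splitSum_congr fun t c h => splitSum_congr fun a b h' => ?_
    subst h h'
    simp only [atLeft_sumMul, atRight_sumMul, mul_assoc]

/-- The mould equal to `1` in depth one. -/
def unitOne : List L → L
  | [_] => 1
  | _ => 0

/-- Only flexed words of length one survive. In the left sum this forces `a` empty and `c` a single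
letter, in the right sum `a` a single letter and `c` empty; the two sums are the two halves of
`lu(B, unitOne)`. -/
theorem aritFun_unitOne (B : List L → L) (hB : B [] = 0) :
    aritFun B unitOne = conv B unitOne - conv unitOne B := by
  have hl : aritLeft B unitOne = conv B unitOne := by
    funext w
    refine splitSum_congr fun t c _ => ?_
    rcases t with _ | ⟨x, t⟩ <;> rcases c with _ | ⟨y, _ | ⟨z, c⟩⟩ <;>
      simp [splitSum_cons, atLeft, unitOne, hB, splitSum_eq_zero]
  have hr : aritRight B unitOne = conv unitOne B := by
    funext w
    rw [aritRight, splitSum_assoc fun a b c => atRight unitOne a b c * B b]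
    refine splitSum_congr fun a t _ => ?_
    obtain rfl | ⟨t, y, rfl⟩ := t.eq_nil_or_concat
    · simp [splitSum_nil, hB]
    -- The cut with `c` empty is isolated; in every other cut `a` is empty or the flexed word has at
    -- least two letters.
    · rw [List.concat_eq_append, splitSum_concat, splitSum_eq_zero, zero_add]
      · obtain rfl | ⟨a, x, rfl⟩ := a.eq_nil_or_concat
        · simp [atRight_nil, unitOne]
        · rw [List.concat_eq_append, atRight_concat]
          rcases a with _ | ⟨z, a⟩
          · rfl
          · cases a <;> simp [unitOne]
      · intro b c _
        obtain rfl | ⟨a, x, rfl⟩ := a.eq_nil_or_concat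
        · simp [atRight_nil]
        · rw [List.concat_eq_append, atRight_concat]
          rcases a with _ | ⟨z, a⟩
          · cases c <;> simp [unitOne]
          · cases a <;> simp [unitOne]
  rw [aritFun, hl, hr]

end ListFun

/-! ### A free Lie algebra embeds into the free associative algebra -/

/-- The Euler derivation on a free Lie algebra of characteristic zero is injective. -/
theorem euler_injective {X : Type} (E : FreeLieAlgebra ℚ X →ₗ[ℚ] FreeLieAlgebra ℚ X)
    (hof : ∀ x, E (FreeLieAlgebra.of ℚ x) = FreeLieAlgebra.of ℚ x)
    (hlie : ∀ x y, E ⁅x, y⁆ = ⁅E x, y⁆ + ⁅x, E y⁆) : Function.Injective E := by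
  -- Eigenvalues add under the bracket and the generators have eigenvalue `1`, so the span of the
  -- eigenspaces with positive eigenvalue is a Lie subalgebra containing the generators, hence
  -- everything.
  let V : Submodule ℚ (FreeLieAlgebra ℚ X) := ⨆ c ∈ {c : ℚ | 0 < c}, Module.End.eigenspace E c
  have hmem : ∀ {c : ℚ} {x}, 0 < c → E x = c • x → x ∈ V := fun {c x} hc hx =>
    Submodule.mem_iSup_of_mem c (Submodule.mem_iSup_of_mem hc (Module.End.mem_eigenspace_iff.2 hx))
  have hind : ∀ {p : FreeLieAlgebra ℚ X → Prop} {x}, x ∈ V →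
      (∀ (c : ℚ) y, 0 < c → E y = c • y → p y) → p 0 → (∀ y z, p y → p z → p (y + z)) → p x := by
    intro p x hx h1 h0 hadd
    refine Submodule.iSup_induction _ (motive := p) hx (fun c y hy => ?_) h0 hadd
    by_cases hc : 0 < c
    · simp only [Set.mem_ofPred_eq, hc, iSup_pos] at hy
      exact h1 c y hc (Module.End.mem_eigenspace_iff.1 hy)
    · simp only [Set.mem_ofPred_eq, hc, iSup_false, Submodule.mem_bot] at hy
      exact hy ▸ h0
  let S : LieSubalgebra ℚ (FreeLieAlgebra ℚ X) :=
    { V with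
      lie_mem' := by
        intro x y hx hy
        change ⁅x, y⁆ ∈ V
        refine hind (p := fun x => ⁅x, y⁆ ∈ V) hx (fun c x hc hcx => ?_) (by simp) (fun x z h1 h2 => ?_)
        · refine hind (p := fun y => ⁅x, y⁆ ∈ V) hy (fun d y hd hdy => ?_) (by simp) (fun y z h1 h2 => ?_)
          · refine hmem (add_pos hc hd) ?_
            rw [hlie, hcx, hdy, smul_lie, lie_smul, add_smul]
          · rw [lie_add]
            exact add_mem h1 h2
        · rw [add_lie]
          exact add_mem h1 h2 }
  have htop : ∀ x, x ∈ V := fun x =>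
    mem_of_generators (LieHom.id : FreeLieAlgebra ℚ X →ₗ⁅ℚ⁆ FreeLieAlgebra ℚ X) S
      (fun i => hmem one_pos (by simp [hof])) x
  rw [injective_iff_map_eq_zero]
  intro x hx
  -- The kernel is the eigenspace of `0`, which is independent of all the others.
  have hdis := (Module.End.eigenspaces_iSupIndep E) 0
  rw [Submodule.disjoint_def] at hdis
  refine hdis x (Module.End.mem_eigenspace_iff.2 (by simpa using hx)) ?_
  have hle : V ≤ ⨆ c, ⨆ (_ : c ≠ 0), Module.End.eigenspace E c :=
    iSup_mono fun c => iSup_mono' fun hc => ⟨(ne_of_gt hc), le_rfl⟩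
  exact hle (htop x)

theorem polyC_induction {p : PolyC → Prop}
    (word : ∀ v : List ℕ, p (FreeAlgebra.basisFreeMonoid ℚ ℕ (FreeMonoid.ofList v)))
    (add : ∀ P Q, p P → p Q → p (P + Q)) (smul : ∀ (c : ℚ) P, p P → p (c • P)) (P : PolyC) :
    p P := by
  induction (FreeAlgebra.basisFreeMonoid ℚ ℕ).mem_span P using Submodule.span_induction with
  | mem x h =>
    obtain ⟨v, rfl⟩ := h
    exact word v.toList
  | zero => simpa using smul 0 _ (word [])
  | add x y _ _ hx hy => exact add x y hx hy
  | smul c x _ hx => exact smul c x hx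

/-- The adjoint action of the free associative algebra on the free Lie algebra. -/
noncomputable def adjC : PolyC →ₐ[ℚ] Module.End ℚ (FreeLieAlgebra ℚ ℕ) :=
  FreeAlgebra.lift ℚ fun n => (LieAlgebra.ad ℚ _ (FreeLieAlgebra.of ℚ n) : Module.End ℚ _)

theorem adjC_assocC (P : FreeLieAlgebra ℚ ℕ) : adjC (assocC P) = LieAlgebra.ad ℚ _ P := by
  have h : (adjC.toLieHom).comp assocC = LieAlgebra.ad ℚ (FreeLieAlgebra ℚ ℕ) := by
    apply FreeLieAlgebra.hom_ext
    intro n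
    change adjC (assocC (FreeLieAlgebra.of ℚ n)) = _
    rw [assocC, FreeLieAlgebra.lift_of_apply, adjC, FreeAlgebra.lift_ι_apply]
  exact congrArg (fun f : FreeLieAlgebra ℚ ℕ →ₗ⁅ℚ⁆ Module.End ℚ (FreeLieAlgebra ℚ ℕ) => f P) h

/-- The right-nested bracketing on words. -/
noncomputable def bracketWord : List ℕ → FreeLieAlgebra ℚ ℕ
  | [] => 0
  | [n] => FreeLieAlgebra.of ℚ n
  | n :: m :: v => ⁅FreeLieAlgebra.of ℚ n, bracketWord (m :: v)⁆

/-- The Dynkin operator from the free associative algebra to the free Lie algebra. -/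
noncomputable def dynkin : PolyC →ₗ[ℚ] FreeLieAlgebra ℚ ℕ :=
  (FreeAlgebra.basisFreeMonoid ℚ ℕ).constr ℚ fun w => bracketWord w.toList

theorem basis_mul (v w : FreeMonoid ℕ) :
    FreeAlgebra.basisFreeMonoid ℚ ℕ v * FreeAlgebra.basisFreeMonoid ℚ ℕ w =
      FreeAlgebra.basisFreeMonoid ℚ ℕ (v * w) := by
  simp [FreeAlgebra.basisFreeMonoid, FreeAlgebra.equivMonoidAlgebraFreeMonoid]

theorem basis_one : FreeAlgebra.basisFreeMonoid ℚ ℕ 1 = 1 := by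
  simp [FreeAlgebra.basisFreeMonoid, FreeAlgebra.equivMonoidAlgebraFreeMonoid]

theorem basis_of (n : ℕ) :
    FreeAlgebra.basisFreeMonoid ℚ ℕ (FreeMonoid.of n) = FreeAlgebra.ι ℚ n := by
  simp [FreeAlgebra.basisFreeMonoid, FreeAlgebra.equivMonoidAlgebraFreeMonoid]

/-- The constant coefficient. -/
noncomputable def constC : PolyC →ₐ[ℚ] ℚ := FreeAlgebra.lift ℚ fun _ => 0

theorem constC_assocC (P : FreeLieAlgebra ℚ ℕ) : constC (assocC P) = 0 := by
  have h : (constC.toLieHom).comp assocC = 0 := by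
    apply FreeLieAlgebra.hom_ext
    intro n
    change constC (assocC (FreeLieAlgebra.of ℚ n)) = 0
    rw [assocC, FreeLieAlgebra.lift_of_apply, constC, FreeAlgebra.lift_ι_apply]
  exact congrArg (fun f : FreeLieAlgebra ℚ ℕ →ₗ⁅ℚ⁆ ℚ => f P) h

theorem constC_basis (n : ℕ) (v : List ℕ) :
    constC (FreeAlgebra.basisFreeMonoid ℚ ℕ (FreeMonoid.ofList (n :: v))) = 0 := by
  rw [FreeMonoid.ofList_cons, ← basis_mul, basis_of, map_mul, constC, FreeAlgebra.lift_ι_apply,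
    zero_mul]

theorem dynkin_basis (v : List ℕ) :
    dynkin (FreeAlgebra.basisFreeMonoid ℚ ℕ (FreeMonoid.ofList v)) = bracketWord v := by
  rw [dynkin, Module.Basis.constr_basis, FreeMonoid.toList_ofList]

theorem dynkin_one : dynkin 1 = 0 := by
  rw [← basis_one, ← FreeMonoid.ofList_nil, dynkin_basis, bracketWord]

/-- The correction term comes from the empty word alone: its bracketing is `0`, whereas the
one-letter word is sent to a generator. -/
theorem dynkin_ι_mul (n : ℕ) (Q : PolyC) :
    dynkin (FreeAlgebra.ι ℚ n * Q) =
      ⁅FreeLieAlgebra.of ℚ n, dynkin Q⁆ + constC Q • FreeLieAlgebra.of ℚ n := by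
  induction Q using polyC_induction with
  | add P Q hP hQ => simp only [mul_add, map_add, hP, hQ, lie_add, add_smul]; abel
  | smul c P hP => simp only [mul_smul_comm, map_smul, hP, lie_smul, smul_add, smul_smul, smul_eq_mul]
  | word v =>
    rw [← basis_of, basis_mul, ← FreeMonoid.ofList_cons, dynkin_basis, dynkin_basis]
    cases v with
    | nil => simp [bracketWord, basis_one]
    | cons m v => rw [constC_basis, zero_smul, add_zero, bracketWord]

/-- Without a constant term in `Q` the correction in `dynkin_ι_mul` vanishes at each letter, so the
letters of `P` act one after another by `ad`. -/
theorem dynkin_mul (P Q : PolyC) (hQ : constC Q = 0) :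
    dynkin (P * Q) = adjC P (dynkin Q) := by
  induction P using FreeAlgebra.induction generalizing Q with
  | grade0 c => simp [adjC, Algebra.algebraMap_eq_smul_one]
  | grade1 n => simp [dynkin_ι_mul, hQ, adjC]
  | add P P' h h' => simp [add_mul, h Q hQ, h' Q hQ]
  | mul P P' h h' =>
    rw [mul_assoc, h _ (by rw [map_mul, hQ, mul_zero]), h' Q hQ, map_mul, Module.End.mul_apply]

/-- Dynkin–Specht–Wever: the Dynkin operator composed with `assocC` is a derivation fixing the
generators, hence injective by `euler_injective`. -/
theorem assocC_injective : Function.Injective assocC := by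
  let E : FreeLieAlgebra ℚ ℕ →ₗ[ℚ] FreeLieAlgebra ℚ ℕ :=
    dynkin ∘ₗ (assocC : FreeLieAlgebra ℚ ℕ →ₗ[ℚ] PolyC)
  have hE : Function.Injective E := by
    refine euler_injective E (fun n => ?_) (fun x y => ?_)
    · change dynkin (assocC (FreeLieAlgebra.of ℚ n)) = _
      rw [assocC, FreeLieAlgebra.lift_of_apply, ← mul_one (FreeAlgebra.ι ℚ n), dynkin_ι_mul,
        dynkin_one, lie_zero, map_one, zero_add, one_smul]
    · change dynkin (assocC ⁅x, y⁆) = ⁅dynkin (assocC x), y⁆ + ⁅x, dynkin (assocC y)⁆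
      rw [LieHom.map_lie, Ring.lie_def, map_sub, dynkin_mul _ _ (constC_assocC y),
        dynkin_mul _ _ (constC_assocC x), adjC_assocC, adjC_assocC, LieAlgebra.ad_apply,
        LieAlgebra.ad_apply, ← lie_skew y]
      abel
  exact Function.Injective.of_comp (f := dynkin) hE

/-! ### Evaluating noncommutative polynomials at lists -/

section Eval

variable {L : Type} [Field L]

/-- The value of `ma` of a word in the `Cᵢ` at a list. -/
def evWord : List ℕ → List L → L
  | [], [] => 1
  | n :: v, x :: w => (-x) ^ n * evWord v w
  | [], _ :: _ => 0
  | _ :: _, [] => 0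

theorem conv_cons (f g : List L → L) (x : L) (w : List L) :
    conv f g (x :: w) = f [] * g (x :: w) + conv (fun t => f (x :: t)) g w :=
  splitSum_cons _ _ _

theorem conv_nil (f g : List L → L) : conv f g [] = f [] * g [] := splitSum_nil _

/-- The value of a word is zero on lists of a different length, so at most one cut contributes. -/
theorem evWord_append (v v' : List ℕ) :
    (evWord (v ++ v') : List L → L) = conv (evWord v) (evWord v') := by
  funext w
  induction v generalizing w with
  | nil =>
    cases w with
    | nil => simp [conv_nil, evWord]
    | cons x w =>
      rw [conv_cons, conv, splitSum_eq_zero fun _ _ _ => by rw [evWord, zero_mul], add_zero, evWord,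
        one_mul, List.nil_append]
  | cons n v ih =>
    cases w with
    | nil => simp [conv_nil, evWord]
    | cons x w =>
      simp only [List.cons_append, evWord, conv_cons, ih, zero_mul, zero_add]
      simp only [conv, mul_splitSum, mul_assoc]

theorem sumMul_add (f g : List L → L) : sumMul (f + g) = sumMul f + sumMul g :=
  funext fun _ => mul_add _ _ _

variable [Algebra ℚ L]

theorem conv_smul (c : ℚ) (f g : List L → L) : conv f (c • g) = c • conv f g := by
  funext w
  simp only [conv, Pi.smul_apply, Algebra.smul_def, mul_splitSum]
  exact splitSum_congr fun _ _ _ => by ring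

theorem smul_conv (c : ℚ) (f g : List L → L) : conv (c • f) g = c • conv f g := by
  funext w
  simp only [conv, Pi.smul_apply, Algebra.smul_def, mul_splitSum]
  exact splitSum_congr fun _ _ _ => by ring

variable (L) in
/-- The value of `ma P` at a list. -/
noncomputable def evPoly : PolyC →ₗ[ℚ] (List L → L) :=
  (FreeAlgebra.basisFreeMonoid ℚ ℕ).constr ℚ fun v => evWord v.toList

theorem evPoly_basis (v : List ℕ) :
    evPoly L (FreeAlgebra.basisFreeMonoid ℚ ℕ (FreeMonoid.ofList v)) = evWord v := by
  rw [evPoly, Module.Basis.constr_basis, FreeMonoid.toList_ofList]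

theorem evPoly_one : evPoly L 1 = evWord [] := by
  rw [← basis_one, ← FreeMonoid.ofList_nil, evPoly_basis]

theorem evPoly_ι (n : ℕ) : evPoly L (FreeAlgebra.ι ℚ n) = evWord [n] := by
  rw [← basis_of, ← FreeMonoid.ofList_singleton, evPoly_basis]

theorem evPoly_mul (P Q : PolyC) : evPoly L (P * Q) = conv (evPoly L P) (evPoly L Q) := by
  induction P using polyC_induction with
  | word v =>
    induction Q using polyC_induction with
    | word v' =>
      rw [basis_mul, ← FreeMonoid.ofList_append, evPoly_basis, evPoly_basis, evPoly_basis,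
        evWord_append]
    | add Q Q' h h' => rw [mul_add, map_add, map_add, h, h', conv_add]
    | smul c Q h => rw [mul_smul_comm, map_smul, map_smul, h, conv_smul]
  | add P P' h h' => rw [add_mul, map_add, map_add, h, h', add_conv]
  | smul c P h => rw [smul_mul_assoc, map_smul, map_smul, h, smul_conv]

/-- `shiftC` and minus `sumMul` are both derivations, and on a letter the identity is `(-x)^(n+1) =
-x (-x)^n`. This is what the sign in `ma` is for. -/
theorem evPoly_shiftC (P : PolyC) : evPoly L (shiftC P) = -sumMul (evPoly L P) := by
  induction P using FreeAlgebra.induction with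
  | grade0 c =>
    rw [Algebra.algebraMap_eq_smul_one, map_smul, shiftC_one, smul_zero, map_zero, map_smul,
      evPoly_one]
    funext w
    cases w <;> simp [sumMul, evWord]
  | grade1 n =>
    rw [shiftC_ι, evPoly_ι, evPoly_ι]
    funext w
    rcases w with _ | ⟨x, _ | ⟨y, w⟩⟩ <;> simp [sumMul, evWord, pow_succ']
  | mul P Q h h' =>
    rw [shiftC_mul, map_add, evPoly_mul, evPoly_mul, evPoly_mul, h, h', sumMul_conv, neg_conv,
      conv_neg, neg_add]
  | add P Q h h' => rw [map_add, map_add, map_add, h, h', sumMul_add, neg_add]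

theorem evPoly_nil (P : PolyC) : evPoly L P [] = algebraMap ℚ L (constC P) := by
  induction P using polyC_induction with
  | word v =>
    rw [evPoly_basis]
    cases v with
    | nil => simp [evWord, basis_one]
    | cons n v => rw [constC_basis, map_zero, evWord]
  | add P Q h h' => rw [map_add, map_add, map_add, Pi.add_apply, h, h']
  | smul c P h => rw [map_smul, map_smul, Pi.smul_apply, h, smul_eq_mul, map_mul, Algebra.smul_def]

theorem aeval_maPoly {r : ℕ} (v : Fin r → L) (P : PolyC) :
    MvPolynomial.aeval v (maPoly P r) = evPoly L P (List.ofFn v) := by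
  induction P using polyC_induction with
  | word u =>
    rw [evPoly_basis, maPoly, Module.Basis.constr_basis, FreeMonoid.toList_ofList]
    induction u generalizing r with
    | nil =>
      cases r with
      | zero => simp [evWord]
      | succ r => simp [evWord, FreeMonoid.length]
    | cons n u ih =>
      cases r with
      | zero => simp [evWord, FreeMonoid.length]
      | succ r =>
        have := ih fun i => v i.succ
        simp only [FreeMonoid.length, FreeMonoid.toList_ofList] at this ⊢
        rw [List.ofFn_succ, evWord, ← this]
        by_cases h : u.length = r
        · simp only [h, List.length_cons, if_true, map_mul, map_prod, map_pow, MvPolynomial.aeval_X,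
            Fin.prod_univ_succ, map_neg, map_one, List.sum_cons, pow_add, neg_pow (v 0) n,
            Fin.val_zero, Fin.val_succ, List.getD_cons_zero, List.getD_cons_succ]
          ring
        · simp [h]
  | add P Q h h' => rw [map_add, map_add, Pi.add_apply, map_add, h, h', Pi.add_apply]
  | smul c P h => rw [map_smul, map_smul, Pi.smul_apply, map_smul, h, Pi.smul_apply]

theorem aeval_Delta {r : ℕ} (v : Fin r → L) :
    MvPolynomial.aeval v (Delta r) = (List.ofFn v).prod * (List.ofFn v).sum := by
  simp [Delta, List.prod_ofFn, List.sum_ofFn]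

end Eval

/-! ### Expressing Lie polynomials in the `Cᵢ` -/

theorem exists_toPolyC_eq_assocC (F : LieAB) :
    ∃ P, F = coeffA F • genA + expandC P ∧ toPolyC F = assocC P := by
  obtain ⟨P, h⟩ := exists_eq_expandC F
  refine ⟨P, h, ?_⟩
  conv_lhs => rw [h]
  exact toPolyC_eq _ P

theorem constC_toPolyC (F : LieAB) : constC (toPolyC F) = 0 := by
  obtain ⟨P, -, h⟩ := exists_toPolyC_eq_assocC F
  rw [h, constC_assocC]

theorem toPolyC_eq_zero {F : LieAB} (hF : coeffA F = 0) (h : toPolyC F = 0) : F = 0 := by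
  obtain ⟨P, h1, h2⟩ := exists_toPolyC_eq_assocC F
  rw [h, eq_comm, ← map_zero assocC] at h2
  rw [h1, hF, assocC_injective h2, map_zero, zero_smul, zero_add]

theorem toPolyC_lie_genA (F : LieAB) : toPolyC ⁅genA, F⁆ = shiftC (toPolyC F) := by
  change actC ⁅genA, F⁆ 1 = shiftC (actC F 1)
  rw [LieHom.map_lie, actC_genA, Ring.lie_def]
  simp [shiftC_one]

theorem toPolyC_lie {F G : LieAB} (hF : coeffA F = 0) (hG : coeffA G = 0) :
    toPolyC ⁅F, G⁆ = toPolyC F * toPolyC G - toPolyC G * toPolyC F := by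
  obtain ⟨P, h1, h2⟩ := exists_toPolyC_eq_assocC F
  obtain ⟨Q, h3, h4⟩ := exists_toPolyC_eq_assocC G
  rw [h2, h4, ← Ring.lie_def, ← LieHom.map_lie, ← toPolyC_eq 0, LieHom.map_lie, zero_smul,
    zero_add, h1, h3, hF, hG, zero_smul, zero_add, zero_add]

theorem toPolyC_genB : toPolyC genB = FreeAlgebra.ι ℚ 0 := by
  change actC genB 1 = _
  rw [actC_genB]
  simp

/-- Distinct words of the same length give distinct monomials, and the sign is its own inverse, so
the coefficient of each word can be recovered. -/
theorem maPoly_coeff (P : PolyC) (v : List ℕ) :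
    (FreeAlgebra.basisFreeMonoid ℚ ℕ).repr P (FreeMonoid.ofList v) =
      (-1) ^ v.sum * MvPolynomial.coeff (Finsupp.equivFunOnFinite.symm fun i : Fin v.length => v.get i)
        (maPoly P v.length) := by
  classical
  induction P using polyC_induction with
  | word u =>
    rw [Module.Basis.repr_self, maPoly, Module.Basis.constr_basis, FreeMonoid.toList_ofList]
    by_cases h : u.length = v.length
    · have hm : (∏ i : Fin v.length, MvPolynomial.X i ^ u.getD i 0 : MvPolynomial _ ℚ) =
          MvPolynomial.monomial (Finsupp.equivFunOnFinite.symm fun i : Fin v.length =>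
            u.getD i 0) 1 := by
        rw [MvPolynomial.monomial_eq, Finsupp.prod_fintype _ _ (by simp)]
        simp
      have hs : ((-1) ^ u.sum : MvPolynomial (Fin v.length) ℚ) =
          MvPolynomial.C ((-1) ^ u.sum) := by simp
      rw [FreeMonoid.length, FreeMonoid.toList_ofList, if_pos h, hm, hs, MvPolynomial.coeff_C_mul,
        MvPolynomial.coeff_monomial, Finsupp.single_apply]
      by_cases huv : u = v
      · subst huv
        simp [← mul_pow]
      · rw [if_neg (by simpa using huv), if_neg, mul_zero, mul_zero]
        intro he
        refine huv (List.ext_get h fun i h1 h2 => ?_)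
        have := congrFun (Finsupp.equivFunOnFinite.symm.injective he) ⟨i, h2⟩
        simpa [h1] using this
    · rw [FreeMonoid.length, FreeMonoid.toList_ofList, if_neg h, MvPolynomial.coeff_zero, mul_zero,
        Finsupp.single_apply, if_neg]
      intro he
      exact h (congrArg List.length (FreeMonoid.ofList.injective he))
  | add P Q h h' =>
    rw [map_add, map_add, Pi.add_apply, Finsupp.add_apply, MvPolynomial.coeff_add, h, h', mul_add]
  | smul c P h =>
    rw [map_smul, map_smul, Pi.smul_apply, Finsupp.smul_apply, MvPolynomial.coeff_smul, h]
    simp only [smul_eq_mul]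
    ring

theorem maPoly_injective : Function.Injective maPoly := by
  rw [injective_iff_map_eq_zero]
  intro P hP
  refine (FreeAlgebra.basisFreeMonoid ℚ ℕ).ext_elem fun v => ?_
  rw [← FreeMonoid.ofList_toList v, maPoly_coeff, hP]
  simp

/-! ### Agreement on lists with entries in a positive cone -/

section Cone

variable {L : Type} [Field L] (N : AddSubsemigroup L)

/-- Equality on all lists with entries in `N`. -/
def EqOnCone (f g : List L → L) : Prop := ∀ w : List L, (∀ x ∈ w, x ∈ N) → f w = g w

variable {N}

/-- The extra summand `z` is needed because `b` may be empty and `0` need not lie in `N`. -/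
theorem list_sum_add_mem {b : List L} (hb : ∀ x ∈ b, x ∈ N) {z : L} (hz : z ∈ N) :
    b.sum + z ∈ N := by
  induction b with
  | nil => simpa using hz
  | cons x b ih =>
    rw [List.sum_cons, add_assoc]
    exact N.add_mem (hb x (by simp)) (ih fun y hy => hb y (by simp [hy]))

theorem list_sum_mem {w : List L} (hw : ∀ x ∈ w, x ∈ N) (h : w ≠ []) : w.sum ∈ N := by
  obtain ⟨x, w, rfl⟩ := List.exists_cons_of_ne_nil h
  rw [List.sum_cons, add_comm]
  exact list_sum_add_mem (fun y hy => hw y (by simp [hy])) (hw x (by simp))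

theorem splitSum_congr_of_mem {M : Type} [AddCommMonoid M] {φ ψ : List L → List L → M} {w : List L}
    (hw : ∀ x ∈ w, x ∈ N)
    (h : ∀ a b, (∀ x ∈ a, x ∈ N) → (∀ x ∈ b, x ∈ N) → φ a b = ψ a b) :
    splitSum φ w = splitSum ψ w := by
  refine splitSum_congr fun a b hab => h a b (fun x hx => hw x ?_) fun x hx => hw x ?_
  all_goals
    rw [← hab]
    simp [hx]

theorem EqOnCone.conv {f f' g g' : List L → L} (hf : EqOnCone N f f') (hg : EqOnCone N g g') :
    EqOnCone N (conv f g) (conv f' g') := fun _ hw =>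
  splitSum_congr_of_mem hw fun a b ha hb => by rw [hf a ha, hg b hb]

theorem atLeft_congr {A A' : List L → L} (hA : EqOnCone N A A') {a b c : List L}
    (ha : ∀ x ∈ a, x ∈ N) (hb : ∀ x ∈ b, x ∈ N) (hc : ∀ x ∈ c, x ∈ N) :
    atLeft A a b c = atLeft A' a b c := by
  cases c with
  | nil => rfl
  | cons z c =>
    refine hA _ fun x hx => ?_
    simp only [List.mem_append, List.mem_cons] at hx
    rcases hx with hx | rfl | hx
    · exact ha x hx
    · exact list_sum_add_mem hb (hc z (by simp))
    · exact hc x (by simp [hx])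

theorem atRight_congr {A A' : List L → L} (hA : EqOnCone N A A') {a b c : List L}
    (ha : ∀ x ∈ a, x ∈ N) (hb : ∀ x ∈ b, x ∈ N) (hc : ∀ x ∈ c, x ∈ N) :
    atRight A a b c = atRight A' a b c := by
  obtain rfl | ⟨a, z, rfl⟩ := a.eq_nil_or_concat
  · rw [atRight_nil, atRight_nil]
  · rw [List.concat_eq_append] at ha ⊢
    rw [atRight_concat, atRight_concat]
    refine hA _ fun x hx => ?_
    simp only [List.mem_append, List.mem_cons] at hx
    rcases hx with hx | rfl | hx
    · exact ha x (by simp [hx])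
    · rw [add_comm]
      exact list_sum_add_mem hb (ha z (by simp))
    · exact hc x hx

theorem EqOnCone.aritFun {A A' B B' : List L → L} (hB : EqOnCone N B B') (hA : EqOnCone N A A') :
    EqOnCone N (aritFun B A) (aritFun B' A') := by
  intro w hw
  rw [EllipticMould.aritFun, EllipticMould.aritFun, Pi.sub_apply, Pi.sub_apply]
  congr 1
  all_goals
    refine splitSum_congr_of_mem hw fun t c ht hc =>
      splitSum_congr_of_mem ht fun a b ha hb => ?_
  · rw [atLeft_congr hA ha hb hc, hB b hb]
  · rw [atRight_congr hA ha hb hc, hB b hb]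

/-- The operator `A ↦ lu(B,A) - arit(B)·A`. -/
def luArit (B A : List L → L) : List L → L := conv B A - conv A B - aritFun B A

theorem EqOnCone.luArit {A A' B : List L → L} (hA : EqOnCone N A A') :
    EqOnCone N (luArit B A) (luArit B A') := by
  have hB : EqOnCone N B B := fun _ _ => rfl
  intro w hw
  simp only [EllipticMould.luArit, Pi.sub_apply]
  rw [(hB.conv hA) w hw, (hA.conv hB) w hw, (hB.aritFun hA) w hw]

/-- `lu(B, ·)` is an inner derivation of the concatenation product, and `arit(B)` is a derivation by
`aritFun_conv`. -/
theorem luArit_conv (B A₁ A₂ : List L → L) :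
    luArit B (conv A₁ A₂) = conv (luArit B A₁) A₂ + conv A₁ (luArit B A₂) := by
  simp only [luArit, aritFun_conv, sub_conv, conv_sub, conv_assoc]
  abel

/-- Since `sumMul` commutes with `arit(B)` and is a derivation of `conv`, only the inner part
produces an extra term. It mirrors `[D a, F]` in `D[a, F] = [D a, F] + [a, D F]`. -/
theorem luArit_sumMul (B A : List L → L) :
    sumMul (luArit B A) =
      luArit B (sumMul A) + (conv (sumMul B) A - conv A (sumMul B)) := by
  have h : ∀ f g : List L → L, sumMul (f - g) = sumMul f - sumMul g :=
    fun f g => funext fun _ => mul_sub _ _ _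
  simp only [luArit, h, aritFun_sumMul, sumMul_conv]
  abel

theorem aritFun_add_right (B A A' : List L → L) :
    aritFun B (A + A') = aritFun B A + aritFun B A' := by
  have hl : ∀ a b c, atLeft (A + A') a b c = atLeft A a b c + atLeft A' a b c := by
    intro a b c
    cases c <;> simp [atLeft]
  have hr : ∀ a b c, atRight (A + A') a b c = atRight A a b c + atRight A' a b c := by
    intro a b c
    by_cases h : a = [] <;> simp [atRight, h]
  funext w
  simp only [aritFun, aritLeft, aritRight, hl, hr, add_mul, splitSum_add, Pi.add_apply,
    Pi.sub_apply]
  ring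

theorem aritFun_smul_right [Algebra ℚ L] (c : ℚ) (B A : List L → L) :
    aritFun B (c • A) = c • aritFun B A := by
  have hl : ∀ a b d, atLeft (c • A) a b d = algebraMap ℚ L c * atLeft A a b d := by
    intro a b d
    cases d <;> simp [atLeft, Algebra.smul_def]
  have hr : ∀ a b d, atRight (c • A) a b d = algebraMap ℚ L c * atRight A a b d := by
    intro a b d
    by_cases h : a = [] <;> simp [atRight, h, Algebra.smul_def]
  funext w
  simp only [aritFun, aritLeft, aritRight, hl, hr, mul_assoc, ← mul_splitSum,
    Pi.smul_apply, Pi.sub_apply]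
  rw [Algebra.smul_def, mul_sub]

theorem luArit_add (B A A' : List L → L) : luArit B (A + A') = luArit B A + luArit B A' := by
  simp only [luArit, conv_add, add_conv, aritFun_add_right]
  abel

theorem luArit_smul [Algebra ℚ L] (c : ℚ) (B A : List L → L) :
    luArit B (c • A) = c • luArit B A := by
  funext w
  simp only [luArit, conv_smul, smul_conv, aritFun_smul_right, Pi.sub_apply, Pi.smul_apply]
  simp only [Algebra.smul_def]
  ring

theorem luArit_neg (B A : List L → L) : luArit B (-A) = -luArit B A := by
  have h := luArit_add B A (-A)
  have h0 : luArit B (0 : List L → L) = 0 := by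
    have := luArit_add B 0 0
    rwa [add_zero, right_eq_add] at this
  rw [add_neg_cancel, h0] at h
  exact (neg_eq_of_add_eq_zero_right h.symm).symm

theorem luArit_sub (B A A' : List L → L) : luArit B (A - A') = luArit B A - luArit B A' := by
  rw [sub_eq_add_neg, luArit_add, luArit_neg, sub_eq_add_neg]

theorem div_prod_conv (f g : List L → L) (w : List L) :
    conv f g w / w.prod = conv (fun w => f w / w.prod) (fun w => g w / w.prod) w := by
  simp only [conv, div_eq_mul_inv, splitSum_mul]
  refine splitSum_congr fun a b h => ?_
  rw [← h, List.prod_append, mul_inv]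
  ring

theorem luArit_nil {B A : List L → L} (hB : B [] = 0) : luArit B A [] = 0 := by
  simp [luArit, conv_nil, aritFun, aritLeft, aritRight, splitSum_nil, hB]

/-- The sum of a nonempty list from `N` lies in `N`, so it can be cancelled; the empty list has sum
`0` and needs the separate hypothesis. -/
theorem eqOnCone_of_sumMul (hN : (0 : L) ∉ N) {f g : List L → L} (h0 : f [] = g [])
    (h : EqOnCone N (sumMul f) (sumMul g)) : EqOnCone N f g := by
  intro w hw
  by_cases hne : w = []
  · rw [hne, h0]
  · have hs : w.sum ≠ 0 := fun h => hN (h ▸ list_sum_mem hw hne)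
    exact mul_left_cancel₀ hs (h w hw)

end Cone

/-! ### The action of a derivation on normalized moulds -/

section Action

variable {L : Type} [Field L] [Algebra ℚ L]

variable (L) in
/-- The mould `ma(F) / (u₁ ⋯ u_r)`. -/
noncomputable def normMa : LieAB →ₗ[ℚ] (List L → L) where
  toFun F w := evPoly L (toPolyC F) w / w.prod
  map_add' F G := by
    funext w
    simp [add_div]
  map_smul' c F := by
    funext w
    simp [smul_div_assoc]

theorem normMa_lie {F G : LieAB} (hF : coeffA F = 0) (hG : coeffA G = 0) :
    normMa L ⁅F, G⁆ = conv (normMa L F) (normMa L G) - conv (normMa L G) (normMa L F) := by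
  funext w
  change evPoly L (toPolyC ⁅F, G⁆) w / w.prod = _
  rw [toPolyC_lie hF hG, map_sub, evPoly_mul, evPoly_mul, Pi.sub_apply, sub_div, div_prod_conv,
    div_prod_conv]
  rfl

theorem normMa_lie_genA (F : LieAB) : normMa L ⁅genA, F⁆ = -sumMul (normMa L F) := by
  funext w
  change evPoly L (toPolyC ⁅genA, F⁆) w / w.prod = -(w.sum * (evPoly L (toPolyC F) w / w.prod))
  rw [toPolyC_lie_genA, evPoly_shiftC, Pi.neg_apply, sumMul]
  ring

theorem normMa_nil (F : LieAB) : normMa L F [] = 0 := by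
  change evPoly L (toPolyC F) [] / _ = 0
  rw [evPoly_nil, constC_toPolyC, map_zero, zero_div]

variable (L) in
/-- The mould `ma(F) / (u₁ ⋯ u_r (u₁ + ⋯ + u_r))`. -/
noncomputable def deltaMa (F : LieAB) : List L → L := fun w => normMa L F w / w.sum

theorem deltaMa_nil (F : LieAB) : deltaMa L F [] = 0 := by
  rw [deltaMa, normMa_nil, zero_div]

variable {N : AddSubsemigroup L} (hN : (0 : L) ∉ N)

include hN

theorem sumMul_deltaMa (F : LieAB) : EqOnCone N (sumMul (deltaMa L F)) (normMa L F) := by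
  intro w hw
  by_cases hne : w = []
  · rw [hne, sumMul, deltaMa_nil, normMa_nil, mul_zero]
  · have hs : w.sum ≠ 0 := fun h => hN (h ▸ list_sum_mem hw hne)
    rw [sumMul, deltaMa, mul_div_cancel₀ _ hs]

theorem sumMul_normMa_genB : EqOnCone N (sumMul (normMa L genB)) unitOne := by
  intro w hw
  change w.sum * (evPoly L (toPolyC genB) w / w.prod) = _
  rw [toPolyC_genB, evPoly_ι]
  rcases w with _ | ⟨x, _ | ⟨y, w⟩⟩
  · simp [unitOne]
  · have hx : x ≠ 0 := fun h => hN (h ▸ hw x (by simp))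
    simp [evWord, unitOne, hx]
  · simp [evWord, unitOne]

/-- After multiplication by the sum of the entries, the left side is determined by `[a, D b] = -[D
a, b]`. On the right, `luArit` kills `unitOne`, and only the extra term of `luArit_sumMul` remains.
-/
theorem normMa_derivation_genB (D : Der0) :
    EqOnCone N (normMa L (D.1 genB)) (luArit (deltaMa L (D.1 genA)) (normMa L genB)) := by
  obtain ⟨D, hab, ha, hb⟩ := D
  change EqOnCone N (normMa L (D genB)) (luArit (deltaMa L (D genA)) (normMa L genB))
  refine eqOnCone_of_sumMul hN (by rw [normMa_nil, luArit_nil (deltaMa_nil _)]) ?_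
  have h1 : sumMul (normMa L (D genB)) =
      conv (normMa L (D genA)) (normMa L genB) - conv (normMa L genB) (normMa L (D genA)) := by
    rw [← normMa_lie ha coeffA_genB, ← neg_neg (sumMul _), ← normMa_lie_genA, ← map_neg]
    congr 1
    rw [LieDerivation.apply_lie_eq_add, add_eq_zero_iff_eq_neg] at hab
    rw [hab, neg_neg]
  have hb : EqOnCone N (normMa L genB) (normMa L genB) := fun _ _ => rfl
  have h2 := sumMul_normMa_genB hN
  have h3 := sumMul_deltaMa hN (D genA)
  have h4 : luArit (deltaMa L (D genA)) unitOne = 0 := by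
    rw [luArit, aritFun_unitOne _ (deltaMa_nil _), sub_self]
  intro w hw
  rw [h1, luArit_sumMul, Pi.add_apply, h2.luArit w hw, h4, Pi.sub_apply, Pi.sub_apply,
    (h3.conv hb) w hw, (hb.conv h3) w hw, Pi.zero_apply, zero_add]

theorem normMa_derivation_lie_genA (D : Der0) {F : LieAB} (hF : coeffA F = 0)
    (h : EqOnCone N (normMa L (D.1 F)) (luArit (deltaMa L (D.1 genA)) (normMa L F))) :
    EqOnCone N (normMa L (D.1 ⁅genA, F⁆))
      (luArit (deltaMa L (D.1 genA)) (normMa L ⁅genA, F⁆)) := by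
  obtain ⟨D, hab, ha, hb⟩ := D
  change EqOnCone N (normMa L (D F)) (luArit (deltaMa L (D genA)) (normMa L F)) at h
  change EqOnCone N (normMa L (D ⁅genA, F⁆)) (luArit (deltaMa L (D genA)) (normMa L ⁅genA, F⁆))
  have h3 := sumMul_deltaMa hN (D genA)
  have hb : EqOnCone N (normMa L F) (normMa L F) := fun _ _ => rfl
  intro w hw
  have h5 := congrFun (luArit_sumMul (deltaMa L (D genA)) (normMa L F)) w
  rw [sumMul, ← h w hw, Pi.add_apply, Pi.sub_apply, (h3.conv hb) w hw, (hb.conv h3) w hw] at h5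
  rw [normMa_lie_genA, luArit_neg, LieDerivation.apply_lie_eq_add, map_add, normMa_lie_genA,
    normMa_lie ha hF]
  simp only [Pi.add_apply, Pi.sub_apply, Pi.neg_apply]
  rw [sumMul, h5]
  ring

/-- A derivation in `Der⁰` acts on normalized moulds as `A ↦ lu(B,A) - arit(B)·A`. -/
theorem normMa_derivation (D : Der0) {F : LieAB} (hF : coeffA F = 0) :
    EqOnCone N (normMa L (D.1 F)) (luArit (deltaMa L (D.1 genA)) (normMa L F)) := by
  -- The condition `coeffA F = 0` is part of the carrier because `normMa_lie` needs it. The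
  -- generators `ad(a)^n (b)` are then reached by induction on `n`.
  let S : LieSubalgebra ℚ LieAB :=
    { carrier := {F | coeffA F = 0 ∧
        EqOnCone N (normMa L (D.1 F)) (luArit (deltaMa L (D.1 genA)) (normMa L F))}
      zero_mem' := by
        refine ⟨map_zero _, fun w _ => ?_⟩
        rw [map_zero, map_zero, ← zero_smul ℚ (0 : List L → L), luArit_smul, zero_smul, zero_smul]
      add_mem' := by
        rintro F G ⟨hF, h⟩ ⟨hG, h'⟩
        refine ⟨by rw [map_add, hF, hG, add_zero], fun w hw => ?_⟩
        rw [map_add, map_add, map_add, luArit_add, Pi.add_apply, Pi.add_apply, h w hw, h' w hw]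
      smul_mem' := by
        rintro c F ⟨hF, h⟩
        refine ⟨by rw [map_smul, hF, smul_zero], fun w hw => ?_⟩
        rw [map_smul, map_smul, map_smul, luArit_smul, Pi.smul_apply, Pi.smul_apply, h w hw]
      lie_mem' := by
        rintro F G ⟨hF, h⟩ ⟨hG, h'⟩
        refine ⟨coeffA_lie F G, fun w hw => ?_⟩
        have hF' := coeffA_derivation D.1 D.2.2.1 D.2.2.2 F
        have hG' := coeffA_derivation D.1 D.2.2.1 D.2.2.2 G
        have eF : EqOnCone N (normMa L F) (normMa L F) := fun _ _ => rfl
        have eG : EqOnCone N (normMa L G) (normMa L G) := fun _ _ => rfl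
        rw [LieDerivation.apply_lie_eq_add, map_add, normMa_lie hF hG', normMa_lie hF' hG,
          normMa_lie hF hG, luArit_sub, luArit_conv, luArit_conv]
        simp only [Pi.add_apply, Pi.sub_apply]
        rw [(eF.conv h') w hw, (h'.conv eF) w hw, (eG.conv h) w hw, (h.conv eG) w hw]
        ring }
  obtain ⟨P, hP⟩ := exists_eq_expandC F
  rw [hF, zero_smul, zero_add] at hP
  rw [hP]
  refine (mem_of_generators expandC S (fun n => ?_) P).2
  rw [expandC_of]
  induction n with
  | zero => exact ⟨coeffA_genB, normMa_derivation_genB hN D⟩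
  | succ n ih =>
    rw [pow_succ', Module.End.mul_apply, LieAlgebra.ad_apply]
    exact ⟨coeffA_lie _ _, normMa_derivation_lie_genA hN D ih.1 ih.2⟩

/-- The bracket formula on functions of lists. -/
theorem deltaMa_lie (D₁ D₂ : Der0) :
    EqOnCone N (deltaMa L ((⁅D₁, D₂⁆ : Der0).1 genA))
      (aritFun (deltaMa L (D₂.1 genA)) (deltaMa L (D₁.1 genA)) -
        aritFun (deltaMa L (D₁.1 genA)) (deltaMa L (D₂.1 genA)) +
        (conv (deltaMa L (D₁.1 genA)) (deltaMa L (D₂.1 genA)) -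
          conv (deltaMa L (D₂.1 genA)) (deltaMa L (D₁.1 genA)))) := by
  have hD : (⁅D₁, D₂⁆ : Der0).1 genA = D₁.1 (D₂.1 genA) - D₂.1 (D₁.1 genA) :=
    LieDerivation.lie_apply _ _ _
  have h1 := sumMul_deltaMa hN (D₁.1 genA)
  have h2 := sumMul_deltaMa hN (D₂.1 genA)
  have h12 := normMa_derivation hN D₁ D₂.2.2.1
  have h21 := normMa_derivation hN D₂ D₁.2.2.1
  set B₁ := deltaMa L (D₁.1 genA) with hB₁
  set B₂ := deltaMa L (D₂.1 genA) with hB₂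
  refine eqOnCone_of_sumMul hN ?_ fun w hw => ?_
  · simp [deltaMa_nil, conv_nil, aritFun, aritLeft, aritRight, splitSum_nil, hB₁, hB₂]
  rw [sumMul_deltaMa hN _ w hw, hD, map_sub, Pi.sub_apply, h12 w hw, h21 w hw,
    ← h2.luArit w hw, ← h1.luArit w hw]
  have h : ∀ f g : List L → L, sumMul (f - g) = sumMul f - sumMul g :=
    fun f g => funext fun _ => mul_sub _ _ _
  -- With `s` for `sumMul`: `s` passes through both `arit` terms, and `lu(B₁, sB₂) + lu(sB₁, B₂) =
  -- s·lu(B₁, B₂)`.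
  simp only [luArit, sumMul_add, h, sumMul_conv, aritFun_sumMul, Pi.add_apply, Pi.sub_apply]
  ring

end Action

/-! ### Moulds as functions of lists -/

theorem evalAt_nil {L : Type} [Field L] [Algebra ℚ L] {A : Mould} (hA : A 0 = 0) :
    evalAt A ([] : List L) = 0 := by
  refine (ratEval_eq (A 0) ([] : List L).get 0 1 ?_ ?_).trans ?_
  · rw [map_one]
    exact one_ne_zero
  · rw [hA, zero_mul, map_zero]
  · rw [map_zero, zero_div]

theorem vars_length (r : ℕ) : (vars r).length = r := by simp [vars]

theorem mu_eq_conv (A B : Mould) (r : ℕ) :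
    mu A B r = conv (evalAt A) (evalAt B) (vars r) := by
  rw [mu, conv, splitSum, vars_length]

/-- The sums over all factorizations contain extra terms, all zero: those with `b` empty by `B(∅) =
0`, and those with `c` (left) or `a` (right) empty by the default values of `atLeft` and `atRight`.
-/
theorem arit_eq_aritFun {A B : Mould} (hB : B 0 = 0) (r : ℕ) :
    arit B A r = aritFun (evalAt B) (evalAt A) (vars r) := by
  have hB' : evalAt B ([] : List (RatFun r)) = 0 := evalAt_nil hB
  have key : ∀ (τ : List (RatFun r) → List (RatFun r) → List (RatFun r) → RatFun r),
      splitSum (fun t c => splitSum (fun a b => τ a b c * evalAt B b) t) (vars r) =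
        ∑ l ∈ range (r + 1), ∑ k ∈ range l, τ ((vars r).take k) (((vars r).take l).drop k)
          ((vars r).drop l) * evalAt B (((vars r).take l).drop k) := by
    intro τ
    rw [splitSum, vars_length]
    refine sum_congr rfl fun l hl => ?_
    have hl' : ((vars r).take l).length = l := by
      rw [List.length_take, vars_length]
      exact min_eq_left (Nat.lt_succ_iff.1 (mem_range.1 hl))
    rw [splitSum, hl', sum_range_succ, List.drop_eq_nil_of_le hl'.le, hB', mul_zero, add_zero]
    refine sum_congr rfl fun k hk => ?_
    rw [List.take_take, min_eq_left (mem_range.1 hk).le]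
  rw [arit, aritFun, Pi.sub_apply, aritLeft, aritRight, key, key]
  congr 1
  -- The term `l = r` has `c` empty.
  · rw [sum_range_succ, List.drop_eq_nil_of_le (vars_length r).le]
    rw [sum_eq_zero (s := range r) (f := fun k => atLeft _ _ _ [] * _)
      fun k _ => by rw [atLeft, zero_mul], add_zero]
    refine sum_congr rfl fun l hl => sum_congr rfl fun k _ => ?_
    have hd : (vars r).drop l ≠ [] := by
      rw [Ne, List.drop_eq_nil_iff, vars_length]
      exact not_le.2 (mem_range.1 hl)
    obtain ⟨z, c, hc⟩ := List.exists_cons_of_ne_nil hd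
    rw [hc]
    rfl
  -- The term `l = 0` is an empty sum over `k`; the terms `k = 0`, with `a` empty, are removed
  -- below.
  · rw [sum_range_succ', range_zero, sum_empty, add_zero, ← Finset.Ico_add_one_right_eq_Icc,
      sum_Ico_eq_sum_range]
    refine sum_congr (by simp) fun l hl => ?_
    rw [sum_range_succ', List.take_zero, atRight_nil, zero_mul, add_zero, add_comm 1 l,
      sum_Ico_eq_sum_range]
    refine sum_congr rfl fun k hk => ?_
    rw [add_comm 1 k, atRight, if_neg]
    rw [List.take_eq_nil_iff]
    rintro (h | h)
    · exact absurd h k.succ_ne_zero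
    · have := vars_length r
      rw [h, List.length_nil] at this
      simp [← this] at hl

/-- The images of the polynomials that are positive at `(1, …, 1)`. -/
def posCone (r : ℕ) : AddSubsemigroup (RatFun r) where
  carrier := {x | ∃ p : MvPolynomial (Fin r) ℚ,
    0 < MvPolynomial.eval (fun _ => 1) p ∧ algebraMap _ (RatFun r) p = x}
  add_mem' := by
    rintro _ _ ⟨p, hp, rfl⟩ ⟨q, hq, rfl⟩
    exact ⟨p + q, by rw [map_add]; exact add_pos hp hq, map_add _ _ _⟩

theorem zero_notMem_posCone (r : ℕ) : (0 : RatFun r) ∉ posCone r := by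
  rintro ⟨p, hp, h⟩
  rw [map_eq_zero_iff _ (IsFractionRing.injective (MvPolynomial (Fin r) ℚ) (RatFun r))] at h
  rw [h, map_zero] at hp
  exact lt_irrefl _ hp

theorem mem_posCone_of_mem_vars {r : ℕ} : ∀ x ∈ vars r, x ∈ posCone r := by
  intro x hx
  obtain ⟨i, rfl⟩ := List.mem_ofFn.1 hx
  exact ⟨MvPolynomial.X i, by simp, rfl⟩

theorem prod_ne_zero_of_mem {L : Type} [Field L] {N : AddSubsemigroup L} (hN : (0 : L) ∉ N)
    {w : List L} (hw : ∀ x ∈ w, x ∈ N) : w.prod ≠ 0 :=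
  List.prod_ne_zero fun h => hN (hw 0 h)

/-- On nonempty lists from the cone `Δ_r` does not vanish, so evaluation through the reduced
fraction agrees with evaluation of the given quotient. -/
theorem evalAt_Da {L : Type} [Field L] [Algebra ℚ L] {N : AddSubsemigroup L} (hN : (0 : L) ∉ N)
    (F : LieAB) : EqOnCone N (evalAt (Da F).1) (deltaMa L F) := by
  intro w hw
  by_cases hne : w = []
  · rw [hne, deltaMa_nil, evalAt_nil (Da F).2]
  have hd : MvPolynomial.aeval w.get (Delta w.length) ≠ 0 := by
    rw [aeval_Delta, List.ofFn_get]
    exact mul_ne_zero (prod_ne_zero_of_mem hN hw) fun h => hN (h ▸ list_sum_mem hw hne)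
  have hd' : algebraMap _ (RatFun w.length) (Delta w.length) ≠ 0 := by
    rw [Ne, map_eq_zero_iff _ (IsFractionRing.injective (MvPolynomial _ ℚ) (RatFun w.length))]
    rintro h
    exact hd (by rw [h, map_zero])
  have hl : w.length ≠ 0 := fun h => hne (List.length_eq_zero_iff.1 h)
  rw [evalAt, ratEval_eq _ _ (ma F w.length) (Delta w.length) hd, aeval_Delta]
  · change MvPolynomial.aeval w.get (maPoly (toPolyC F) w.length) / _ =
      evPoly L (toPolyC F) w / w.prod / w.sum
    rw [aeval_maPoly, List.ofFn_get, div_div]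
  · change (if w.length = 0 then 0 else _) * _ = _
    rw [if_neg hl, div_mul_cancel₀ _ hd']

theorem algebraMap_eq_aeval {r : ℕ} (p : MvPolynomial (Fin r) ℚ) :
    algebraMap _ (RatFun r) p =
      MvPolynomial.aeval (fun i => algebraMap (MvPolynomial (Fin r) ℚ) (RatFun r) (MvPolynomial.X i)) p := by
  have h : IsScalarTower.toAlgHom ℚ (MvPolynomial (Fin r) ℚ) (RatFun r) =
      MvPolynomial.aeval (fun i => algebraMap (MvPolynomial (Fin r) ℚ) (RatFun r) (MvPolynomial.X i)) := by
    ext i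
    simp
  exact congrArg (fun f : MvPolynomial (Fin r) ℚ →ₐ[ℚ] RatFun r => f p) h

theorem algebraMap_maPoly (P : PolyC) (r : ℕ) :
    algebraMap _ (RatFun r) (maPoly P r) = evPoly (RatFun r) P (vars r) := by
  rw [algebraMap_eq_aeval, aeval_maPoly, vars]

theorem Da_apply (F : LieAB) (r : ℕ) : (Da F).1 r = deltaMa (RatFun r) F (vars r) := by
  by_cases hr : r = 0
  · subst hr
    exact ((Da F).2).trans (deltaMa_nil F).symm
  · change (if r = 0 then 0 else _) = evPoly (RatFun r) (toPolyC F) (vars r) / _ / _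
    rw [if_neg hr, algebraMap_eq_aeval (Delta r), aeval_Delta, div_div, ← algebraMap_maPoly]
    rfl

theorem Psi_lie (D₁ D₂ : Der0) : Psi ⁅D₁, D₂⁆ = ari (Psi D₁) (Psi D₂) := by
  apply Subtype.ext
  funext r
  -- The cone contains the variables, hence also every block sum created by the flexions.
  have hN := zero_notMem_posCone r
  have hw := mem_posCone_of_mem_vars (r := r)
  have h1 := evalAt_Da hN (D₁.1 genA)
  have h2 := evalAt_Da hN (D₂.1 genA)
  change (Da ((⁅D₁, D₂⁆ : Der0).1 genA)).1 r =
    arit (Da (D₂.1 genA)).1 (Da (D₁.1 genA)).1 r - arit (Da (D₁.1 genA)).1 (Da (D₂.1 genA)).1 r +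
      (mu (Da (D₁.1 genA)).1 (Da (D₂.1 genA)).1 r - mu (Da (D₂.1 genA)).1 (Da (D₁.1 genA)).1 r)
  rw [Da_apply, deltaMa_lie hN D₁ D₂ _ hw, arit_eq_aritFun (Da _).2, arit_eq_aritFun (Da _).2,
    mu_eq_conv, mu_eq_conv, h2.aritFun h1 _ hw, h1.aritFun h2 _ hw, h1.conv h2 _ hw,
    h2.conv h1 _ hw]
  rfl

/-! ### Injectivity -/

theorem maPoly_toPolyC_zero (F : LieAB) : maPoly (toPolyC F) 0 = 0 := by
  apply IsFractionRing.injective (MvPolynomial (Fin 0) ℚ) (RatFun 0)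
  rw [algebraMap_maPoly, map_zero]
  change evPoly (RatFun 0) (toPolyC F) [] = 0
  rw [evPoly_nil, constC_toPolyC, map_zero]

/-- A Lie polynomial without linear term in `a` is determined by `ma` in positive depth. -/
theorem eq_zero_of_evPoly {F : LieAB} (hF : coeffA F = 0)
    (h : ∀ r ≠ 0, evPoly (RatFun r) (toPolyC F) (vars r) = 0) : F = 0 := by
  refine toPolyC_eq_zero hF (maPoly_injective ?_)
  rw [map_zero]
  funext r
  by_cases hr : r = 0
  · subst hr
    exact maPoly_toPolyC_zero F
  · apply IsFractionRing.injective (MvPolynomial (Fin r) ℚ) (RatFun r)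
    rw [algebraMap_maPoly, h r hr]
    exact (map_zero _).symm

theorem vars_sum_ne_zero {r : ℕ} (hr : r ≠ 0) : (vars r).sum ≠ 0 := fun h =>
  zero_notMem_posCone r (h ▸ list_sum_mem mem_posCone_of_mem_vars fun h' =>
    hr (by rw [← vars_length r, h', List.length_nil]))

theorem eq_zero_of_Da_eq_zero {F : LieAB} (hF : coeffA F = 0) (h : Da F = 0) : F = 0 := by
  refine eq_zero_of_evPoly hF fun r hr => ?_
  have h0 : evPoly (RatFun r) (toPolyC F) (vars r) / (vars r).prod / (vars r).sum = 0 := by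
    have := Da_apply F r
    rw [h] at this
    exact this.symm
  simpa [vars_sum_ne_zero hr, prod_ne_zero_of_mem (zero_notMem_posCone r) mem_posCone_of_mem_vars]
    using h0

/-- The centralizer of `a` contains no nonzero element without linear term in `a`. -/
theorem eq_zero_of_lie_genA {F : LieAB} (hF : coeffA F = 0) (h : ⁅genA, F⁆ = 0) : F = 0 := by
  refine eq_zero_of_evPoly hF fun r hr => ?_
  have h0 := congrFun (evPoly_shiftC (L := RatFun r) (toPolyC F)) (vars r)
  rw [← toPolyC_lie_genA, h, map_zero, map_zero, Pi.zero_apply, Pi.neg_apply, zero_eq_neg,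
    sumMul] at h0
  exact (mul_eq_zero.1 h0).resolve_left (vars_sum_ne_zero hr)

/-- Once `D(a) = 0`, the condition `D[a,b] = 0` puts `D(b)` in the centralizer of `a`, so it
vanishes too. A derivation killing both generators is zero. -/
theorem Psi_injective : Function.Injective Psi := by
  rw [injective_iff_map_eq_zero]
  rintro ⟨D, hab, ha, hb⟩ h
  have hA : D genA = 0 := eq_zero_of_Da_eq_zero ha h
  rw [LieDerivation.apply_lie_eq_add, hA, zero_lie, add_zero] at hab
  have hB : D genB = 0 := eq_zero_of_lie_genA hb hab
  let S : LieSubalgebra ℚ LieAB :=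
    { LinearMap.ker (D : LieAB →ₗ[ℚ] LieAB) with
      lie_mem' := by
        intro x y hx hy
        change D x = 0 at hx
        change D y = 0 at hy
        change D ⁅x, y⁆ = 0
        rw [LieDerivation.apply_lie_eq_add, hx, hy, lie_zero, zero_lie, add_zero] }
  apply Subtype.ext
  ext x
  refine mem_of_generators (LieHom.id : LieAB →ₗ⁅ℚ⁆ LieAB) S (fun i => ?_) x
  fin_cases i
  · exact hA
  · exact hB

end EllipticMould

theorem theoremB3 :
    Function.Injective EllipticMould.Psi ∧
      ∀ D₁ D₂ : EllipticMould.Der0,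
        EllipticMould.Psi ⁅D₁, D₂⁆ = EllipticMould.ari (EllipticMould.Psi D₁) (EllipticMould.Psi D₂) :=
  ⟨EllipticMould.Psi_injective, EllipticMould.Psi_lie⟩
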